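/- Let $k$ be a field, $S=k[x_1,\dots,x_n]$, and let $M\subsetneq S$ be a proper monomial ideal minimally generated by monomials $m_1,\dots,m_r$. **Notation.** Let $L_M$ be the lcm-lattice of $M$ (all least common multiples of subsets of $\{m_1,\dots,m_r\}$, ordered by divisibility, with bottom element $1$). For $m\in L_M$ put $A_m=\{j : m_j\mid m\}$, and for $m\ne 1$ let $\Delta_m=\langle A_\beta : \beta \text{ is covered by } m \text{ in } L_M\rangle$ be the simplicial complex generated by these sets (so $\Delta_{m_j}=\{\emptyset\}$). $\widetilde H$ denotes reduced simplicial homology with respect to the vertex order $1<\dots<r$. For $m\in L_M$ and $i\ge 0$ let $\mathcal B_i(m)=\{\widetilde m\in L_M : 1\neq\widetilde m<m,\ \widetilde H_{i-1}(\Delta_{\widetilde m};k)\ne 0\}$, and let $\Delta_m^{(i)}=\langle A_\gamma : \gamma \text{ maximal in } \mathcal B_i(m)\rangle\subseteq\Delta_m$. Sequences $\cdots\to F_2\to F_1\to F_0$ of finitely generated multigraded free $S$-modules and multigraded homomorphisms carry fixed multigraded bases; two of them are called *equal* if there are multidegree-preserving bijections between the bases in each homological degree under which the matrices agree. A minimal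 free resolution of $S/M$ is understood to be multigraded, finite, and equipped with a fixed multigraded basis. **Construction of $\mathcal G(L_M)$.** Choose a basis of $\widetilde H_q(\Delta_m;k)$ for all $1\ne m\in L_M$ and $q\ge -1$, where the basis of $\widetilde H_{-1}(\Delta_{m_j};k)=\widetilde H_{-1}(\{\emptyset\};k)$ is the class $[\emptyset]$; and for every $m$, every $i\ge 2$ and every chosen basis element $[e_j]$ of $\widetilde H_{i-2}(\Delta_m;k)$ choose one $[g_j]\in\widetilde H_{i-2}(\Delta_m^{(i-2)};k)$ mapping to $[e_j]$ under the map induced by inclusion. For $\gamma$ maximal in $\mathcal B_{i-2}(m)$ put $\Delta_1=\langle A_\gamma\rangle$ and $\Delta_2=\langle A_{\gamma'} : \gamma'\neq\gamma \text{ maximal in } \mathcal B_{i-2}(m)\rangle$, so that $\Delta_1\cup\Delta_2=\Delta_m^{(i-2)}$ and $\Delta_1\cap\Delta_2\subseteq\Delta_\gamma$, and let $\psi_{i,m}^{\gamma}:\widetilde H_{i-2}(\Delta_m;k)\to\widetilde H_{i-3}(\Delta_\gamma;k)$ be the linear map sending each $[e_j]$ to $\iota(\delta([g_j]))$. Here $\delta:\widetilde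 H_{i-2}(\Delta_m^{(i-2)};k)\to\widetilde H_{i-3}(\Delta_1\cap\Delta_2;k)$ is the Mayer–Vietoris connecting homomorphism ($\delta[c_1-c_2]=[d(c_1)]$ for chains $c_1$ in $\Delta_1$, $c_2$ in $\Delta_2$) and $\iota$ is induced by inclusion. For all other $\gamma\ne 1$ put $\psi_{i,m}^\gamma=0$. Then $\mathcal G(L_M)$ is the sequence in which $\mathcal G_0=S$ with basis element of multidegree $1$; for $i\ge 1$, $\mathcal G_i=\bigoplus_{1\ne m\in L_M}\widetilde H_{i-2}(\Delta_m;k)\otimes S$ with the chosen basis elements of $\widetilde H_{i-2}(\Delta_m;k)$ in multidegree $m$; $\mathcal G_1\to\mathcal G_0$ has matrix $(m_1\ \cdots\ m_r)$; and, for $i\ge 2$, $\mathcal G_i\to\mathcal G_{i-1}$ has the components $\frac{m}{\gamma}\otimes\psi_{i,m}^{\gamma}$. **Maximal approximation.** For a minimal free resolution $(\mathbf F,\partial)$ of $S/M$ with its fixed basis, $\mathbf F^{\approx}$ is the sequence with the same modules and bases obtained from $\partial$ as follows: for a basis element $e$ of $F_i$ and a basis element $e_j$ of $F_{i-1}$,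 the coefficient of $e_j$ in $\partial(e)$ is replaced by $0$ if there is a basis element $e_l$ of $F_{i-1}$ with $\mathrm{mdeg}(e_j)<\mathrm{mdeg}(e_l)<\mathrm{mdeg}(e)$ (strict divisibility), and is kept otherwise. **Theorem.** (1) Let $(\mathbf F,\partial)$ be a minimal free resolution of $S/M$ such that $F_1\xrightarrow{\partial_1}F_0$ is (up to the order of the basis elements) $S(-m_1)\oplus\cdots\oplus S(-m_r)\xrightarrow{(m_1\ \cdots\ m_r)}S$. Then $\mathbf F^{\approx}$ is equal to a sequence $\mathcal G(L_M)$ obtained from some choices in the construction above. (2) Conversely, for every $\mathcal G(L_M)$ obtained from any choices in the construction above there is a minimal free resolution $(\mathbf F,\partial)$ of $S/M$ such that $\mathcal G(L_M)$ is equal to $\mathbf F^{\approx}$. -/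

import Mathlib

open scoped Classical

namespace MonRes

noncomputable section

universe u

/-! ### Simplicial chains and reduced homology

A simplicial complex (with the empty face) on the vertex set `Fin r` is a lower set of finite
sets of vertices.  The complex generated by faces `A₁, …, A_t` is their lower closure; the void
complex is `⊥`, and `{∅}` is the complex whose only face is the empty one. Chains are indexed by
the number `c` of vertices of a face, so that `c` stands for dimension `c - 1`. -/

section Homology

variable (k : Type u) [Field k] {r : ℕ}

/-- The boundary map on the chains of the full simplex with vertex set `Fin r`:
`d {a₀ < ⋯ < a_q} = ∑ j, (-1)^j {a₀, …, a_q} \ {a_j}`. The chain `∑ A, λ_A A` is the function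
`A ↦ λ_A`. -/
def boundary : (Finset (Fin r) → k) →ₗ[k] (Finset (Fin r) → k) :=
  Fintype.linearCombination k fun A : Finset (Fin r) =>
    ∑ a ∈ A, (-1 : k) ^ (A.filter (· < a)).card • Pi.single (A.erase a) (1 : k)

/-- The chains of the simplicial complex `Δ` supported on faces with `c` vertices. -/
def chains (Δ : LowerSet (Finset (Fin r))) (c : ℕ) : Submodule k (Finset (Fin r) → k) where
  carrier := {f | ∀ A, f A ≠ 0 → A ∈ Δ ∧ A.card = c}
  add_mem' {f g} hf hg A h := by
    by_cases h0 : f A = 0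
    · exact hg A fun h1 => h (by simp [h0, h1])
    · exact hf A h0
  zero_mem' A h := absurd rfl h
  smul_mem' t f hf A h := hf A fun h0 => h (by simp [h0])

/-- Cycles of dimension `c - 1`. -/
def cycles (Δ : LowerSet (Finset (Fin r))) (c : ℕ) : Submodule k (Finset (Fin r) → k) :=
  chains k Δ c ⊓ LinearMap.ker (boundary k)

/-- Boundaries of dimension `c - 1`. -/
def boundaries (Δ : LowerSet (Finset (Fin r))) (c : ℕ) : Submodule k (Finset (Fin r) → k) :=
  (chains k Δ (c + 1)).map (boundary k)

/-- The reduced simplicial homology group `H̃_{c-1}(Δ; k)`. -/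
abbrev RedHomology (Δ : LowerSet (Finset (Fin r))) (c : ℕ) : Type u :=
  cycles k Δ c ⧸ (boundaries k Δ c).submoduleOf (cycles k Δ c)

/-- The homology class of a cycle. -/
def homologyClass (Δ : LowerSet (Finset (Fin r))) (c : ℕ) :
    cycles k Δ c →ₗ[k] RedHomology k Δ c :=
  Submodule.mkQ _

variable {k}

lemma mem_chains {Δ : LowerSet (Finset (Fin r))} {c : ℕ} {f : Finset (Fin r) → k} :
    f ∈ chains k Δ c ↔ ∀ A, f A ≠ 0 → A ∈ Δ ∧ A.card = c :=
  Iff.rfl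

lemma boundary_single (A : Finset (Fin r)) :
    boundary k (Pi.single A 1) =
      ∑ a ∈ A, (-1 : k) ^ (A.filter (· < a)).card • Pi.single (A.erase a) (1 : k) := by
  simp [boundary]

lemma boundary_boundary (f : Finset (Fin r) → k) : boundary k (boundary k f) = 0 := by
  suffices h : (boundary k).comp (boundary k) = (0 : (Finset (Fin r) → k) →ₗ[k] _) from
    LinearMap.congr_fun h f
  refine LinearMap.pi_ext' fun A => ?_
  ext1
  simp only [LinearMap.comp_apply, LinearMap.coe_single, boundary_single, map_sum, map_smul,
    LinearMap.zero_apply, Finset.smul_sum]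
  rw [Finset.sum_sigma']
  refine Finset.sum_involution (fun p _ => ⟨p.2, p.1⟩) ?_ ?_ ?_ ?_
  · rintro ⟨a, b⟩ hp
    simp only [Finset.mem_sigma, Finset.mem_erase] at hp
    obtain ⟨ha, hba, hb⟩ := hp
    dsimp only
    rw [Finset.erase_right_comm (a := a) (b := b), smul_smul, smul_smul, ← add_smul]
    have key : ∀ x y : Fin r, x ∈ A → x < y →
        (A.filter (· < y)).card = ((A.erase x).filter (· < y)).card + 1 := by
      intro x y hx hxy
      rw [Finset.filter_erase, Finset.card_erase_add_one]
      simp [hx, hxy]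
    have key' : ∀ x y : Fin r, y < x →
        (A.filter (· < y)).card = ((A.erase x).filter (· < y)).card := by
      intro x y hxy
      rw [Finset.filter_erase, Finset.erase_eq_of_notMem]
      simp [hxy.le]
    have hs : (-1 : k) ^ (A.filter (· < a)).card * (-1) ^ ((A.erase a).filter (· < b)).card +
        (-1) ^ (A.filter (· < b)).card * (-1) ^ ((A.erase b).filter (· < a)).card = 0 := by
      rcases lt_or_gt_of_ne hba with h | h
      · rw [key b a hb h, key' a b h]
        ring
      · rw [key a b ha h, key' b a h]
        ring
    rw [hs, zero_smul]
  · rintro ⟨a, b⟩ hp _ heq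
    simp only [Finset.mem_sigma, Finset.mem_erase] at hp
    simp only [Sigma.mk.injEq] at heq
    exact hp.2.1 heq.1
  · rintro ⟨a, b⟩ hp
    simp only [Finset.mem_sigma, Finset.mem_erase] at hp ⊢
    exact ⟨hp.2.2, Ne.symm hp.2.1, hp.1⟩
  · rintro ⟨a, b⟩ _
    rfl

lemma boundary_mem_chains {Δ : LowerSet (Finset (Fin r))} {c : ℕ} {f : Finset (Fin r) → k}
    (hf : f ∈ chains k Δ (c + 1)) : boundary k f ∈ chains k Δ c := by
  rw [boundary, Fintype.linearCombination_apply]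
  refine Submodule.sum_mem _ fun A _ => ?_
  by_cases h0 : f A = 0
  · rw [h0, zero_smul]
    exact Submodule.zero_mem _
  obtain ⟨hA1, hA2⟩ := hf A h0
  refine Submodule.smul_mem _ _ (Submodule.sum_mem _ fun a ha => Submodule.smul_mem _ _ ?_)
  intro B hB
  obtain rfl : B = A.erase a := by
    by_contra hne
    exact hB (Pi.single_eq_of_ne hne _)
  refine ⟨Δ.lower (Finset.erase_subset _ _) hA1, ?_⟩
  rw [Finset.card_erase_of_mem ha, hA2, Nat.add_sub_cancel]

lemma chains_mono {Δ Δ' : LowerSet (Finset (Fin r))} (h : Δ ≤ Δ') (c : ℕ) :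
    chains k Δ c ≤ chains k Δ' c :=
  fun _ hf A hA => ⟨h (hf A hA).1, (hf A hA).2⟩

lemma cycles_mono {Δ Δ' : LowerSet (Finset (Fin r))} (h : Δ ≤ Δ') (c : ℕ) :
    cycles k Δ c ≤ cycles k Δ' c :=
  inf_le_inf_right _ (chains_mono h c)

/-- The map `H̃_{c-1}(Δ; k) → H̃_{c-1}(Δ'; k)` induced by an inclusion `Δ ⊆ Δ'`. -/
def inclusionMap {Δ Δ' : LowerSet (Finset (Fin r))} (h : Δ ≤ Δ') (c : ℕ) :
    RedHomology k Δ c →ₗ[k] RedHomology k Δ' c :=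
  Submodule.mapQ _ _ (Submodule.inclusion (cycles_mono h c))
    (fun _ hz => Submodule.map_mono (chains_mono h (c + 1)) hz)

/-- The part of a chain that is supported on the faces of `Δ`. -/
def restrictTo (Δ : LowerSet (Finset (Fin r))) :
    (Finset (Fin r) → k) →ₗ[k] (Finset (Fin r) → k) where
  toFun f A := if A ∈ Δ then f A else 0
  map_add' f g := by
    ext A
    by_cases h : A ∈ Δ <;> simp [h]
  map_smul' t f := by
    ext A
    by_cases h : A ∈ Δ <;> simp [h]

lemma restrictTo_apply (Δ : LowerSet (Finset (Fin r))) (f : Finset (Fin r) → k)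
    (A : Finset (Fin r)) : restrictTo Δ f A = if A ∈ Δ then f A else 0 :=
  rfl

lemma restrictTo_eq_self {Δ : LowerSet (Finset (Fin r))} {c : ℕ} {f : Finset (Fin r) → k}
    (hf : f ∈ chains k Δ c) : restrictTo Δ f = f := by
  ext A
  rw [restrictTo_apply]
  split_ifs with h
  · rfl
  · by_contra h0
    exact h (mem_chains.1 hf A (Ne.symm h0)).1

lemma restrictTo_mem {Δ Δ' : LowerSet (Finset (Fin r))} {c : ℕ} {f : Finset (Fin r) → k}
    (hf : f ∈ chains k Δ' c) : restrictTo Δ f ∈ chains k (Δ ⊓ Δ') c := by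
  rw [mem_chains] at hf ⊢
  intro A hA
  rw [restrictTo_apply] at hA
  split_ifs at hA with h
  · exact ⟨⟨h, (hf A hA).1⟩, (hf A hA).2⟩
  · exact absurd rfl hA

lemma sub_restrictTo_mem {Δ₁ Δ₂ : LowerSet (Finset (Fin r))} {c : ℕ}
    {f : Finset (Fin r) → k} (hf : f ∈ chains k (Δ₁ ⊔ Δ₂) c) :
    f - restrictTo Δ₁ f ∈ chains k Δ₂ c := by
  rw [mem_chains] at hf ⊢
  intro A hA
  rw [Pi.sub_apply, restrictTo_apply] at hA
  split_ifs at hA with h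
  · exact absurd (sub_self _) hA
  · rw [sub_zero] at hA
    exact ⟨((hf A hA).1).resolve_left h, (hf A hA).2⟩

lemma boundary_restrictTo_mem_cycles {Δ₁ Δ₂ : LowerSet (Finset (Fin r))} {c : ℕ}
    {f : Finset (Fin r) → k} (hf : f ∈ cycles k (Δ₁ ⊔ Δ₂) (c + 1)) :
    boundary k (restrictTo Δ₁ f) ∈ cycles k (Δ₁ ⊓ Δ₂) c := by
  refine ⟨?_, boundary_boundary _⟩
  have h1 : boundary k (restrictTo Δ₁ f) ∈ chains k Δ₁ c :=
    boundary_mem_chains (chains_mono inf_le_left _ (restrictTo_mem hf.1))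
  have h2 : boundary k (restrictTo Δ₁ f) ∈ chains k Δ₂ c := by
    have h := boundary_mem_chains (sub_restrictTo_mem hf.1)
    rw [map_sub, LinearMap.mem_ker.1 hf.2, zero_sub] at h
    exact neg_mem_iff.1 h
  exact mem_chains.2 fun A hA =>
    ⟨⟨(mem_chains.1 h1 A hA).1, (mem_chains.1 h2 A hA).1⟩, (mem_chains.1 h1 A hA).2⟩

lemma boundary_restrictTo_mem_boundaries {Δ₁ Δ₂ : LowerSet (Finset (Fin r))} {c : ℕ}
    {f : Finset (Fin r) → k} (hf : f ∈ boundaries k (Δ₁ ⊔ Δ₂) (c + 1)) :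
    boundary k (restrictTo Δ₁ f) ∈ boundaries k (Δ₁ ⊓ Δ₂) c := by
  obtain ⟨g, hg, rfl⟩ := hf
  have h1 : boundary k (restrictTo Δ₁ g) ∈ chains k Δ₁ (c + 1) :=
    boundary_mem_chains (chains_mono inf_le_left _ (restrictTo_mem hg))
  have h2 := boundary_mem_chains (sub_restrictTo_mem hg)
  refine ⟨restrictTo Δ₁ (boundary k (g - restrictTo Δ₁ g)), restrictTo_mem h2, ?_⟩
  rw [map_sub, map_sub, map_sub, restrictTo_eq_self h1, boundary_boundary, sub_zero]

/-- The connecting homomorphism `δ : H̃_c(Δ; k) → H̃_{c-1}(Δ₁ ∩ Δ₂; k)` of the Mayer–Vietoris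
sequence of `Δ = Δ₁ ∪ Δ₂`. It sends the class of `f` to the class of `d c₁`, where `f = c₁ - c₂`
with `c₁` the part of `f` on the faces of `Δ₁` and `c₂` a chain of `Δ₂`; by `connecting_eq` any
other such decomposition gives the same class. -/
def connecting {Δ₁ Δ₂ Δ : LowerSet (Finset (Fin r))} (h : Δ₁ ⊔ Δ₂ = Δ) (c : ℕ) :
    RedHomology k Δ (c + 1) →ₗ[k] RedHomology k (Δ₁ ⊓ Δ₂) c :=
  Submodule.mapQ _ _
    ((boundary k ∘ₗ restrictTo Δ₁).restrict (p := cycles k Δ (c + 1)) (q := cycles k (Δ₁ ⊓ Δ₂) c)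
      (fun f hf => by
        subst h
        exact boundary_restrictTo_mem_cycles hf))
    (fun f hf => by
      subst h
      exact boundary_restrictTo_mem_boundaries hf)

lemma connecting_eq {Δ₁ Δ₂ Δ : LowerSet (Finset (Fin r))} (h : Δ₁ ⊔ Δ₂ = Δ) (c : ℕ)
    (f : cycles k Δ (c + 1)) (c₁ c₂ : Finset (Fin r) → k) (h₁ : c₁ ∈ chains k Δ₁ (c + 1))
    (h₂ : c₂ ∈ chains k Δ₂ (c + 1)) (hf : f.1 = c₁ - c₂)
    (z : cycles k (Δ₁ ⊓ Δ₂) c) (hz : z.1 = boundary k c₁) :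
    connecting (k := k) h c (homologyClass k Δ (c + 1) f) = homologyClass k (Δ₁ ⊓ Δ₂) c z := by
  refine (Submodule.Quotient.eq _).2 ?_
  refine ⟨restrictTo Δ₁ (-c₂), restrictTo_mem (neg_mem h₂), ?_⟩
  have : (f : Finset (Fin r) → k) = c₁ + -c₂ := by rw [hf, sub_eq_add_neg]
  simp [LinearMap.restrict_apply, this, hz, restrictTo_eq_self h₁]

end Homology

/-! ### The lcm-lattice and its simplicial complexes

The exponent vector of a monomial in `x₁, …, x_n` is an element of `Fin n →₀ ℕ`; divisibility is
`≤`, the monomial `1` is `0`, and least common multiples are suprema. -/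

section Lattice

variable {n r : ℕ} (m : Fin r → (Fin n →₀ ℕ))

/-- The lcm-lattice `L_M` of the monomials `m₁, …, m_r`, ordered by divisibility. -/
abbrev LcmLattice : Type :=
  {b : Fin n →₀ ℕ // ∃ A : Finset (Fin r), A.sup m = b}

/-- The label `A_b = {j | m_j divides b}`. -/
def label (b : Fin n →₀ ℕ) : Finset (Fin r) :=
  Finset.univ.filter fun j => m j ≤ b

/-- `⟨A_β | β ∈ T⟩`, the simplicial complex generated by the labels of the elements of `T`. -/
def labelComplex (T : Set (LcmLattice m)) : LowerSet (Finset (Fin r)) :=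
  lowerClosure ((fun β : LcmLattice m => label m β.1) '' T)

/-- The simplicial complex `Δ_b`, generated by the labels of the elements covered by `b` in `L_M`.
For an atom `b` this is `{∅}`, since `b` covers only `1`, whose label is empty. -/
def delta (b : LcmLattice m) : LowerSet (Finset (Fin r)) :=
  labelComplex m {β | β ⋖ b}

variable (k : Type u) [Field k]

/-- The Betti poset `B_M`. -/
def bettiPoset : Set (LcmLattice m) :=
  {b | b.1 = 0 ∨ ∃ c, Nontrivial (RedHomology k (delta m b) c)}

/-- The set `𝓑_i(b)` of all `β ∈ B_M` with `1 ≠ β < b` and `H̃_{i-1}(Δ_β; k) ≠ 0`. -/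
def bettiBelow (i : ℕ) (b : LcmLattice m) : Set (LcmLattice m) :=
  {β | β ∈ bettiPoset m k ∧ β.1 ≠ 0 ∧ β < b ∧ Nontrivial (RedHomology k (delta m β) i)}

/-- The maximal elements of `𝓑_i(b)`. -/
def topBelow (i : ℕ) (b : LcmLattice m) : Set (LcmLattice m) :=
  {γ | Maximal (· ∈ bettiBelow m k i b) γ}

/-- The subcomplex `Δ_b^{(i)}` of `Δ_b`, generated by the labels of the maximal elements of
`𝓑_i(b)`. -/
def deltaSub (i : ℕ) (b : LcmLattice m) : LowerSet (Finset (Fin r)) :=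
  labelComplex m (topBelow m k i b)

variable {m}

lemma mem_labelComplex {T : Set (LcmLattice m)} {A : Finset (Fin r)} :
    A ∈ labelComplex m T ↔ ∃ β ∈ T, A ⊆ label m β.1 := by
  simp [labelComplex, mem_lowerClosure]

lemma subset_label {b : Fin n →₀ ℕ} {A : Finset (Fin r)} : A ⊆ label m b ↔ A.sup m ≤ b := by
  simp [label, Finset.subset_iff, Finset.sup_le_iff]

instance : Finite (LcmLattice m) :=
  Set.finite_range fun A : Finset (Fin r) => A.sup m

lemma mem_delta_of_lt {b β : LcmLattice m} (h : β < b) {A : Finset (Fin r)}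
    (hA : A ⊆ label m β.1) : A ∈ delta m b := by
  obtain ⟨γ, hβγ, hγ⟩ := (Set.toFinite {x : LcmLattice m | x < b}).exists_le_maximal h
  refine mem_labelComplex.2 ⟨γ, ⟨hγ.1, fun x hx hxb => ?_⟩, ?_⟩
  · exact absurd (hγ.2 hxb hx.le) hx.not_ge
  · exact subset_label.2 ((subset_label.1 hA).trans hβγ)

lemma deltaSub_le_delta (i : ℕ) (b : LcmLattice m) : deltaSub m k i b ≤ delta m b := by
  intro A hA
  obtain ⟨γ, hγ, hAγ⟩ := mem_labelComplex.1 hA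
  exact mem_delta_of_lt hγ.1.2.2.1 hAγ

lemma labelComplex_split {T : Set (LcmLattice m)} {γ : LcmLattice m} (hγ : γ ∈ T) :
    labelComplex m {γ} ⊔ labelComplex m (T \ {γ}) = labelComplex m T := by
  rw [labelComplex, labelComplex, labelComplex, ← lowerClosure_union, ← Set.image_union,
    Set.union_sdiff_cancel (Set.singleton_subset_iff.2 hγ)]

lemma inter_le_delta {i : ℕ} {b γ : LcmLattice m} (hγ : γ ∈ topBelow m k i b) :
    labelComplex m {γ} ⊓ labelComplex m (topBelow m k i b \ {γ}) ≤ delta m γ := by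
  rintro A ⟨hA1, hA2⟩
  obtain ⟨_, rfl, h1⟩ := mem_labelComplex.1 hA1
  obtain ⟨γ', ⟨hγ', hne⟩, h2⟩ := mem_labelComplex.1 hA2
  rename_i γ
  let β : LcmLattice m := ⟨A.sup m, A, rfl⟩
  have hβ : β ≤ γ := subset_label.1 h1
  have hβ' : β ≤ γ' := subset_label.1 h2
  have hlt : β < γ := by
    refine lt_of_le_of_ne hβ fun heq => hne ?_
    have hle : γ ≤ γ' := heq ▸ hβ'
    exact le_antisymm (hγ.2 hγ'.1 hle) hle
  exact mem_delta_of_lt hlt (subset_label.2 le_rfl)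

/-- For a maximal element `γ` of `𝓑_c(b)`, the composition
`H̃_c(Δ_b^{(c)}; k) → H̃_{c-1}(Δ₁ ∩ Δ₂; k) → H̃_{c-1}(Δ_γ; k)` of the connecting homomorphism for
`Δ₁ = ⟨A_γ⟩` and `Δ₂ = ⟨A_γ' | γ' ≠ γ maximal⟩` with the map induced by inclusion. -/
def mvMap {c : ℕ} {b γ : LcmLattice m} (hγ : γ ∈ topBelow m k c b) :
    RedHomology k (deltaSub m k c b) (c + 1) →ₗ[k] RedHomology k (delta m γ) c :=
  inclusionMap (inter_le_delta k hγ) c ∘ₗ connecting (labelComplex_split hγ) c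

/-- The choices in the construction of `𝓡(L_M)` and `𝓖(L_M)`: a basis of every
`H̃_{c-1}(Δ_b; k)`, and for every basis element `[e_j]` of `H̃_c(Δ_b; k)`, `c ≥ 0`, a preimage
`[g_j]` in `H̃_c(Δ_b^{(c)}; k)`. The basis of `H̃_{-1}(Δ_b; k) ≅ k` for an atom `b` is the class of
the empty face. -/
structure Choices (m : Fin r → (Fin n →₀ ℕ)) where
  basis : ∀ (b : LcmLattice m) (c : ℕ),
    Module.Basis (Fin (Module.finrank k (RedHomology k (delta m b) c))) k
      (RedHomology k (delta m b) c)
  basis_zero : ∀ (b : LcmLattice m) (a : Fin (Module.finrank k (RedHomology k (delta m b) 0))),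
    ∃ z : cycles k (delta m b) 0, z.1 = Pi.single ∅ 1 ∧
      basis b 0 a = homologyClass k (delta m b) 0 z
  lift : ∀ (b : LcmLattice m) (c : ℕ),
    Fin (Module.finrank k (RedHomology k (delta m b) (c + 1))) →
      RedHomology k (deltaSub m k c b) (c + 1)
  lift_spec : ∀ (b : LcmLattice m) (c : ℕ) (j),
    inclusionMap (k := k) (deltaSub_le_delta k c b) (c + 1) (lift b c j) = basis b (c + 1) j

variable {k}

/-- The component `H̃_c(Δ_b; k) → H̃_{c-1}(Δ_γ; k)` of `ψ_{c+2}`: for `γ` maximal in `𝓑_c(b)` the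
linear map that sends `[e_j]` to the image of `[g_j]` under `mvMap`, and zero for other `γ`. -/
def Choices.psi (C : Choices k m) (c : ℕ) (b γ : LcmLattice m) :
    RedHomology k (delta m b) (c + 1) →ₗ[k] RedHomology k (delta m γ) c :=
  if hγ : γ ∈ topBelow m k c b then
    (C.basis b (c + 1)).constr k fun j => mvMap k hγ (C.lift b c j)
  else 0

lemma Choices.psi_eq_zero (C : Choices k m) {c : ℕ} {b γ : LcmLattice m}
    (h : ¬ γ.1 ≤ b.1) : C.psi c b γ = 0 :=
  dif_neg fun hγ => h hγ.1.2.2.1.le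

end Lattice

/-! ### Multigraded free modules with fixed bases -/

section Multigraded

/-- A sequence `⋯ → F₂ → F₁ → F₀` of finitely generated multigraded free modules over
`S = k[x₁, …, x_n]` with fixed multigraded bases and of multigraded homomorphisms, given by their
matrices: `F_i` has the basis `ι i`, with multidegrees `deg i`, and `d i` is the matrix of
`F_{i+1} → F_i`. It need not be a complex. -/
structure MultigradedSeq (k : Type u) [Field k] (n : ℕ) where
  ι : ℕ → Type
  fin : ∀ i, Fintype (ι i)
  deg : ∀ i, ι i → (Fin n →₀ ℕ)
  d : ∀ i, Matrix (ι i) (ι (i + 1)) (MvPolynomial (Fin n) k)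
  multigraded : ∀ i a b, d i a b = 0 ∨
    deg i a ≤ deg (i + 1) b ∧
      ∃ t : k, d i a b = MvPolynomial.monomial (deg (i + 1) b - deg i a) t

attribute [instance] MultigradedSeq.fin

variable {k : Type u} [Field k] {n r : ℕ}

/-- The monomial ideal generated by the monomials with exponents `m₁, …, m_r`. -/
def monomialIdeal (k : Type u) [Field k] (m : Fin r → (Fin n →₀ ℕ)) :
    Ideal (MvPolynomial (Fin n) k) :=
  Ideal.span (Set.range fun j => MvPolynomial.monomial (m j) (1 : k))

namespace MultigradedSeq

/-- The homomorphism `F_{i+1} → F_i`. -/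
def map (F : MultigradedSeq k n) (i : ℕ) :
    (F.ι (i + 1) → MvPolynomial (Fin n) k) →ₗ[MvPolynomial (Fin n) k]
      (F.ι i → MvPolynomial (Fin n) k) :=
  (F.d i).mulVecLin

/-- `F` is a minimal multigraded free resolution of `S/M`: it is finite, exact in positive degrees,
its cokernel in degree zero is `S/M` through a multigraded augmentation `ε : F₀ → S/M`, and all
matrix entries lie in the ideal `(x₁, …, x_n)`. -/
structure IsMinimalFreeResolution (F : MultigradedSeq k n)
    (M : Ideal (MvPolynomial (Fin n) k)) : Prop where
  bounded : ∃ l, ∀ i, l < i → IsEmpty (F.ι i)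
  exact : ∀ i, Function.Exact (F.map (i + 1)) (F.map i)
  augmentation : ∃ ε : (F.ι 0 → MvPolynomial (Fin n) k) →ₗ[MvPolynomial (Fin n) k]
      (MvPolynomial (Fin n) k ⧸ M),
    Function.Surjective ε ∧ Function.Exact (F.map 0) ε ∧
      ∀ a, ∃ t : k, ε (Pi.single a 1) = Ideal.Quotient.mk M (MvPolynomial.monomial (F.deg 0 a) t)
  minimal : ∀ i a b, F.d i a b ∈ Ideal.span (Set.range (MvPolynomial.X (R := k) (σ := Fin n)))

/-- Up to the order of the basis elements, `F₁ → F₀` is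
`S(-m₁) ⊕ ⋯ ⊕ S(-m_r) → S` with matrix `(m₁ ⋯ m_r)`. -/
def StartsWith (F : MultigradedSeq k n) (m : Fin r → (Fin n →₀ ℕ)) : Prop :=
  ∃ (e₀ : Unit ≃ F.ι 0) (e₁ : Fin r ≃ F.ι 1), F.deg 0 (e₀ ()) = 0 ∧
    ∀ j, F.deg 1 (e₁ j) = m j ∧ F.d 0 (e₀ ()) (e₁ j) = MvPolynomial.monomial (m j) 1

/-- Two sequences are equal if there are bijections of their fixed bases that preserve the
multidegrees and the matrices. -/
def Equal (F G : MultigradedSeq k n) : Prop :=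
  ∃ e : ∀ i, F.ι i ≃ G.ι i, (∀ i a, G.deg i (e i a) = F.deg i a) ∧
    ∀ i a b, G.d i (e i a) (e (i + 1) b) = F.d i a b

/-- The maximal approximation: the entry of the matrix from a basis element `b` of `F_{i+1}` to a
basis element `a` of `F_i` is kept unless there is a basis element `a'` of `F_i` with
`mdeg a < mdeg a' < mdeg b`, in which case it is replaced by `0`. -/
def approx (F : MultigradedSeq k n) : MultigradedSeq k n where
  ι := F.ι
  fin := F.fin
  deg := F.deg
  d i a b := if ∃ a', F.deg i a < F.deg i a' ∧ F.deg i a' < F.deg (i + 1) b then 0 else F.d i a b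
  multigraded i a b := by
    split_ifs
    · exact Or.inl rfl
    · exact F.multigraded i a b

end MultigradedSeq

variable {m : Fin r → (Fin n →₀ ℕ)}

/-- The index set of the fixed basis of `𝓖_i`: the single element `f₀` for `i = 0`, and the chosen
bases of all `H̃_{i-2}(Δ_b; k)`, `1 ≠ b ∈ L_M`, for `i ≥ 1`. -/
def GIndex (k : Type u) [Field k] (m : Fin r → (Fin n →₀ ℕ)) : ℕ → Type
  | 0 => Unit
  | c + 1 => Σ b : {b : LcmLattice m // b.1 ≠ 0},
      Fin (Module.finrank k (RedHomology k (delta m b.1) c))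

/-- The multidegrees of the basis elements of `𝓖_i`. -/
def GDeg (k : Type u) [Field k] (m : Fin r → (Fin n →₀ ℕ)) :
    ∀ i, GIndex k m i → (Fin n →₀ ℕ)
  | 0, _ => 0
  | _ + 1, ⟨b, _⟩ => b.1.1

/-- The matrix of `𝓖_{i+1} → 𝓖_i`: it is `(m₁ ⋯ m_r)` for `i = 0`, and the homogenization
`(b/γ) ⊗ ψ` for `i ≥ 1`. -/
def Choices.GMatrix (C : Choices k m) :
    ∀ i, Matrix (GIndex k m i) (GIndex k m (i + 1)) (MvPolynomial (Fin n) k)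
  | 0 => fun _ ⟨b, _⟩ => MvPolynomial.monomial b.1.1 1
  | c + 1 => fun ⟨γ, a⟩ ⟨b, j⟩ => MvPolynomial.monomial (b.1.1 - γ.1.1)
      (LinearMap.toMatrix (C.basis b.1 (c + 1)) (C.basis γ.1 c) (C.psi c b.1 γ.1) a j)

/-- The sequence `𝓖(L_M)` obtained from the choices `C`. -/
def Choices.G (C : Choices k m) : MultigradedSeq k n where
  ι := GIndex k m
  fin
    | 0 => inferInstanceAs (Fintype Unit)
    | _ + 1 => Fintype.ofFinite (Σ b : {b : LcmLattice m // b.1 ≠ 0}, Fin _)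
  deg := GDeg k m
  d := C.GMatrix
  multigraded
    | 0, _, ⟨b, _⟩ => Or.inr ⟨zero_le, 1, by simp [Choices.GMatrix, GDeg]⟩
    | c + 1, ⟨γ, a⟩, ⟨b, j⟩ => by
      by_cases h : γ.1.1 ≤ b.1.1
      · exact Or.inr ⟨h, _, rfl⟩
      · left
        simp [Choices.GMatrix, C.psi_eq_zero h]

end Multigraded

end

end MonRes

namespace MonRes

noncomputable section

universe u

/-! ### Subcomplexes cut out by lower sets of degrees, and contracting cones -/

section Complexes

variable {k : Type u} [Field k] {n r : ℕ} {m : Fin r → (Fin n →₀ ℕ)}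

/-! With the variables set to 1, the Taylor complex becomes the chain complex of the full simplex on
the generators, each face carrying the degree of its lcm. A minimal resolution embeds in it: a basis
element `e` of `F_i` becomes a chain `w i e` on faces with `i` vertices and lcm dividing the degree
of `e`, and the boundary of `w (i + 1) e` is the combination of the chains `w i a` whose
coefficients are the scalars of the matrix column of `e`. The useful families `w` are those for
which, at every `b` in `L_M`, the boundaries of the chains of degree `b` represent a basis of the
homology of `Δ_b` (`AdmissibleAt`).

Two facts transfer exactness between such a family and the simplex. The chains are linearly
independent (`realize_injective`), and over any lower set of degrees the simplicial chains modulo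
their span are acyclic (`exists_realize_add_boundary`). Moreover the simplex on the label of any
degree contracts to its first vertex, apart from the empty label in dimension -1.

A resolution yields such a family by repeated coning; its exactness and minimality give
admissibility degree by degree (`admissibleAt_taylorLift`). Conversely, choices yield a family by
recursion up the lattice: a representative of `[g_j]` is changed by a boundary inside `Δ_b^{(c)}`
into a combination of chains already built, and then coned off (`exists_chain`). The coefficients of
these combinations are the matrices of the resolution.

In both directions `mvMap_realize` compares the differentials. Split the boundary of `w e` into its
terms of degree at most `γ` and the rest. The boundary of the first part is, modulo boundaries in
`Δ_γ`, the combination of the basis classes at `γ` with the original coefficients. So `ψ` reproduces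
the matrix at maximal `γ`. Nonvanishing homology is the same as the presence of basis elements
(`nontrivial_iff_exists_deg`), hence maximality of `γ` says that no basis degree lies strictly
between `γ` and `b`: these are the entries kept by the maximal approximation. -/

/-- The complex of all sets of generators whose least common multiple lies in `D`. -/
def belowComplex (m : Fin r → (Fin n →₀ ℕ)) (D : LowerSet (Fin n →₀ ℕ)) :
    LowerSet (Finset (Fin r)) where
  carrier := {A | A.sup m ∈ D}
  lower' _ _ hBA hA := D.lower (Finset.sup_mono hBA) hA

lemma mem_belowComplex {D : LowerSet (Fin n →₀ ℕ)} {A : Finset (Fin r)} :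
    A ∈ belowComplex m D ↔ A.sup m ∈ D :=
  Iff.rfl

lemma belowComplex_mono {D D' : LowerSet (Fin n →₀ ℕ)} (h : D ≤ D') :
    belowComplex m D ≤ belowComplex m D' :=
  fun _ hA => h hA

/-- The lcm of a face is itself a lattice element, so covers can be replaced by strict divisibility.
This permits induction over all exponent vectors instead of over covering relations. -/
lemma delta_eq_belowComplex (b : LcmLattice m) :
    delta m b = belowComplex m (LowerSet.Iio b.1) := by
  ext A
  constructor
  · intro hA
    obtain ⟨β, hβ, hAβ⟩ := mem_labelComplex.1 hA
    exact lt_of_le_of_lt (subset_label.1 hAβ) hβ.lt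
  · intro hA
    exact mem_delta_of_lt (β := ⟨A.sup m, A, rfl⟩) hA (subset_label.2 le_rfl)

lemma mem_chains_Iio {b : Fin n →₀ ℕ} {c : ℕ} {f : Finset (Fin r) → k}
    (hf : f ∈ chains k (belowComplex m (LowerSet.Iic b)) c)
    (hb : ∀ A : Finset (Fin r), A.sup m = b → f A = 0) :
    f ∈ chains k (belowComplex m (LowerSet.Iio b)) c := fun A hA =>
  ⟨lt_of_le_of_ne (hf A hA).1 fun h => hA (hb A h), (hf A hA).2⟩

lemma Iio_le_Iic (b : Fin n →₀ ℕ) : LowerSet.Iio b ≤ LowerSet.Iic b :=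
  fun _ h => LowerSet.mem_Iic_iff.2 (LowerSet.mem_Iio_iff.1 h).le

/-- The cone with apex `j`. -/
def coneMap (k : Type u) [Field k] (j : Fin r) :
    (Finset (Fin r) → k) →ₗ[k] (Finset (Fin r) → k) :=
  Fintype.linearCombination k fun A : Finset (Fin r) =>
    if j ∈ A then 0 else Pi.single (insert j A) (1 : k)

lemma coneMap_single (j : Fin r) (A : Finset (Fin r)) :
    coneMap k j (Pi.single A 1) = if j ∈ A then 0 else Pi.single (insert j A) (1 : k) := by
  simp [coneMap]

/-- As `j` precedes every vertex, removing it from the cone has sign `+1`, and inserting it shifts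
the position of every other vertex by one. If `j` already lies in `A`, only the term that removes
`j` survives coning, and it gives back `A`. -/
lemma boundary_coneMap_single {j : Fin r} {A : Finset (Fin r)} (hA : ∀ a ∈ A, j ≤ a) :
    boundary k (coneMap k j (Pi.single A 1)) =
      Pi.single A 1 - coneMap k j (boundary k (Pi.single A 1)) := by
  rw [coneMap_single, boundary_single, map_sum]
  simp only [map_smul, coneMap_single]
  by_cases hj : j ∈ A
  · rw [if_pos hj, map_zero, Finset.sum_eq_single_of_mem j hj]
    · have h0 : A.filter (· < j) = ∅ :=
        Finset.filter_eq_empty_iff.2 fun a ha => not_lt.2 (hA a ha)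
      simp [h0, Finset.insert_erase hj]
    · intro a _ haj
      rw [if_pos (Finset.mem_erase.2 ⟨haj.symm, hj⟩), smul_zero]
  · rw [if_neg hj, boundary_single, Finset.sum_insert hj, Finset.erase_insert hj]
    have h0 : (insert j A).filter (· < j) = ∅ := by
      refine Finset.filter_eq_empty_iff.2 fun a ha => not_lt.2 ?_
      rcases Finset.mem_insert.1 ha with rfl | ha
      · exact le_rfl
      · exact hA a ha
    rw [h0, Finset.card_empty, pow_zero, one_smul, sub_eq_add_neg, ← Finset.sum_neg_distrib]
    congr 1
    refine Finset.sum_congr rfl fun a ha => ?_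
    have hja : j ≠ a := fun h => hj (h ▸ ha)
    have h1 : j ∉ A.erase a := fun h => hj (Finset.mem_of_mem_erase h)
    have h2 : ((insert j A).filter (· < a)).card = (A.filter (· < a)).card + 1 := by
      rw [Finset.filter_insert, if_pos (lt_of_le_of_ne (hA a ha) hja),
        Finset.card_insert_of_notMem fun h => hj (Finset.mem_filter.1 h).1]
    rw [if_neg h1, h2, pow_succ, Finset.erase_insert_of_ne hja, mul_neg_one, neg_smul]

lemma eq_sum_single (f : Finset (Fin r) → k) : f = ∑ A, f A • Pi.single A (1 : k) := by
  ext B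
  simp [Finset.sum_apply, Pi.single_apply]

lemma boundary_coneMap {j : Fin r} {f : Finset (Fin r) → k}
    (hf : ∀ A, f A ≠ 0 → ∀ a ∈ A, j ≤ a) :
    boundary k (coneMap k j f) = f - coneMap k j (boundary k f) := by
  conv_lhs => rw [eq_sum_single f]
  conv_rhs => rw [eq_sum_single f]
  simp only [map_sum, map_smul, ← Finset.sum_sub_distrib, ← smul_sub]
  refine Finset.sum_congr rfl fun A _ => ?_
  by_cases h0 : f A = 0
  · simp [h0]
  · rw [boundary_coneMap_single (hf A h0)]

/-- The cone over the simplex on the label of `b`, with apex its smallest vertex. -/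
def apexCone (k : Type u) [Field k] (m : Fin r → (Fin n →₀ ℕ)) (b : Fin n →₀ ℕ) :
    (Finset (Fin r) → k) →ₗ[k] (Finset (Fin r) → k) :=
  -- With an empty label the only face is `∅` and there is no apex. The value `0` still contracts
  -- every cycle on faces with at least one vertex, since such a cycle vanishes.
  if h : (label m b).Nonempty then coneMap k ((label m b).min' h) else 0

lemma apexCone_mem {b : Fin n →₀ ℕ} {c : ℕ} {f : Finset (Fin r) → k}
    (hf : f ∈ chains k (belowComplex m (LowerSet.Iic b)) c) :
    apexCone k m b f ∈ chains k (belowComplex m (LowerSet.Iic b)) (c + 1) := by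
  rw [apexCone]
  split_ifs with h
  · rw [coneMap, Fintype.linearCombination_apply]
    refine Submodule.sum_mem _ fun A _ => ?_
    by_cases h0 : f A = 0
    · rw [h0, zero_smul]
      exact Submodule.zero_mem _
    obtain ⟨hA1, hA2⟩ := hf A h0
    refine Submodule.smul_mem _ _ ?_
    split_ifs with hj
    · exact Submodule.zero_mem _
    intro B hB
    obtain rfl : B = insert ((label m b).min' h) A := by
      by_contra hne
      exact hB (Pi.single_eq_of_ne hne _)
    refine ⟨?_, by rw [Finset.card_insert_of_notMem hj, hA2]⟩
    rw [mem_belowComplex, Finset.sup_insert]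
    refine sup_le (a := m _) ?_ (LowerSet.mem_Iic_iff.1 hA1)
    exact (Finset.mem_filter.1 ((label m b).min'_mem h)).2
  · exact Submodule.zero_mem _

lemma boundary_apexCone {b : Fin n →₀ ℕ} (hb : (label m b).Nonempty) {c : ℕ}
    {f : Finset (Fin r) → k} (hf : f ∈ cycles k (belowComplex m (LowerSet.Iic b)) c) :
    boundary k (apexCone k m b f) = f := by
  rw [apexCone, dif_pos hb, boundary_coneMap, LinearMap.mem_ker.1 hf.2, map_zero, sub_zero]
  intro A hA a ha
  exact Finset.min'_le _ _ (subset_label.2 (hf.1 A hA).1 ha)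

lemma boundary_apexCone_succ {b : Fin n →₀ ℕ} {c : ℕ}
    {f : Finset (Fin r) → k} (hf : f ∈ cycles k (belowComplex m (LowerSet.Iic b)) (c + 1)) :
    boundary k (apexCone k m b f) = f := by
  by_cases hb : (label m b).Nonempty
  · exact boundary_apexCone hb hf
  · have h0 : f = 0 := by
      ext A
      by_contra hA
      obtain ⟨h1, h2⟩ := hf.1 A hA
      obtain ⟨a, ha⟩ := Finset.card_pos.1 (h2 ▸ Nat.succ_pos c : 0 < A.card)
      exact hb ⟨a, subset_label.2 h1 ha⟩
    rw [h0, map_zero, map_zero]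

lemma label_nonempty {b : LcmLattice m} (hb : b.1 ≠ 0) : (label m b.1).Nonempty := by
  obtain ⟨A, hA⟩ := b.2
  rcases A.eq_empty_or_nonempty with rfl | ⟨a, ha⟩
  · exact absurd hA.symm hb
  · exact ⟨a, subset_label.2 hA.le ha⟩

lemma single_empty_mem_chains {D : LowerSet (Fin n →₀ ℕ)} (hD : 0 ∈ D) :
    (Pi.single ∅ 1 : Finset (Fin r) → k) ∈ chains k (belowComplex m D) 0 := by
  intro A hA
  obtain rfl : A = ∅ := by
    by_contra hne
    exact hA (Pi.single_eq_of_ne hne _)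
  exact ⟨hD, rfl⟩

lemma boundary_single_empty : boundary k (Pi.single (∅ : Finset (Fin r)) 1) = 0 := by
  rw [boundary_single, Finset.sum_empty]

lemma eq_smul_of_mem_chains_zero {Δ : LowerSet (Finset (Fin r))} {f : Finset (Fin r) → k}
    (hf : f ∈ chains k Δ 0) : f = f ∅ • Pi.single ∅ 1 := by
  ext A
  by_cases hA : A = ∅
  · simp [hA]
  · rw [Pi.smul_apply, Pi.single_eq_of_ne hA, smul_zero]
    by_contra h
    exact hA (Finset.card_eq_zero.1 (hf A h).2)

lemma homologyClass_eq_zero {Δ : LowerSet (Finset (Fin r))} {c : ℕ} {z : cycles k Δ c} :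
    homologyClass k Δ c z = 0 ↔ z.1 ∈ boundaries k Δ c := by
  rw [homologyClass, Submodule.mkQ_apply, Submodule.Quotient.mk_eq_zero]
  exact Iff.rfl

lemma homologyClass_surjective (Δ : LowerSet (Finset (Fin r))) (c : ℕ) :
    Function.Surjective (homologyClass k Δ c) :=
  Submodule.mkQ_surjective _

end Complexes

/-! ### Admissible families of chains and relative acyclicity -/

section Frames

variable {k : Type u} [Field k] {n r : ℕ} {m : Fin r → (Fin n →₀ ℕ)}

/-- The coefficient vectors supported on the basis elements with degree in `D`. -/
def supportedOn (k : Type u) [Field k] {X : Type*} (δ : X → (Fin n →₀ ℕ))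
    (D : Set (Fin n →₀ ℕ)) : Submodule k (X → k) where
  carrier := {f | ∀ e, f e ≠ 0 → δ e ∈ D}
  add_mem' {f g} hf hg e h := by
    by_cases h0 : f e = 0
    · exact hg e fun h1 => h (by simp [h0, h1])
    · exact hf e h0
  zero_mem' e h := absurd rfl h
  smul_mem' t f hf e h := hf e fun h0 => h (by simp [h0])

lemma supportedOn_mono {X : Type*} {δ : X → (Fin n →₀ ℕ)} {D D' : Set (Fin n →₀ ℕ)}
    (h : D ⊆ D') : supportedOn k δ D ≤ supportedOn k δ D' :=
  fun _ hf e he => h (hf e he)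

/-- The part of a coefficient vector in degree `b`. -/
def degreePart {X : Type*} (δ : X → (Fin n →₀ ℕ)) (b : Fin n →₀ ℕ) (f : X → k) : X → k :=
  fun e => if δ e = b then f e else 0

lemma degreePart_mem {X : Type*} (δ : X → (Fin n →₀ ℕ)) (b : Fin n →₀ ℕ) (f : X → k) :
    degreePart δ b f ∈ supportedOn k δ {b} := by
  intro e he
  by_contra h
  exact he (if_neg h)

lemma sub_degreePart_mem {X : Type*} {δ : X → (Fin n →₀ ℕ)} {b : Fin n →₀ ℕ}
    {D D' : Set (Fin n →₀ ℕ)} {f : X → k} (hf : f ∈ supportedOn k δ D)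
    (h : ∀ e, δ e ∈ D → δ e ≠ b → δ e ∈ D') : f - degreePart δ b f ∈ supportedOn k δ D' := by
  intro e he
  rw [Pi.sub_apply, degreePart] at he
  split_ifs at he with h1
  · exact absurd (sub_self _) he
  · rw [sub_zero] at he
    exact h e (hf e he) h1

variable {ι : ℕ → Type*}

/-- `F₀` has a single basis element, of degree `1`, which is sent to the empty face. -/
def Grounded (deg : ∀ i, ι i → (Fin n →₀ ℕ)) (w : ∀ i, ι i → (Finset (Fin r) → k)) : Prop :=
  ∃ e₀ : ι 0, (∀ e, e = e₀) ∧ deg 0 e₀ = 0 ∧ w 0 e₀ = Pi.single ∅ 1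

lemma Grounded.deg_zero {deg : ∀ i, ι i → (Fin n →₀ ℕ)} {w : ∀ i, ι i → (Finset (Fin r) → k)}
    (h : Grounded deg w) (e : ι 0) : deg 0 e = 0 := by
  obtain ⟨e₀, h1, h2, h3⟩ := h
  rw [h1 e, h2]

variable [∀ i, Fintype (ι i)]

/-- The linear map sending the basis elements of `F_i` to the chains `w i`. -/
abbrev realize (w : ∀ i, ι i → (Finset (Fin r) → k)) (i : ℕ) :
    (ι i → k) →ₗ[k] (Finset (Fin r) → k) :=
  Fintype.linearCombination k (w i)

/-- The chains `w` of degree `b` have their boundaries in the span of the chains of smaller degree,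
and these boundaries form a basis of the homology of the subcomplex below `b`. -/
structure AdmissibleAt (m : Fin r → (Fin n →₀ ℕ)) (deg : ∀ i, ι i → (Fin n →₀ ℕ))
    (w : ∀ i, ι i → (Finset (Fin r) → k)) (b : Fin n →₀ ℕ) : Prop where
  carried : ∀ i e, deg i e = b → w i e ∈ chains k (belowComplex m (LowerSet.Iic b)) i
  bdry : ∀ i e, deg (i + 1) e = b →
    boundary k (w (i + 1) e) ∈ (supportedOn k (deg i) (Set.Iio b)).map (realize w i)
  indep : ∀ i, ∀ f ∈ supportedOn k (deg (i + 1)) {b},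
    boundary k (realize w (i + 1) f) ∈ boundaries k (belowComplex m (LowerSet.Iio b)) i → f = 0
  -- The restriction to lattice degrees is essential: if `b ≠ 0` is divisible by no generator, the
  -- complex below it is `{∅}`, whose homology in dimension -1 should not contribute a basis
  -- element.
  spans : (∃ A : Finset (Fin r), A.sup m = b) →
    ∀ i, ∀ z ∈ cycles k (belowComplex m (LowerSet.Iio b)) i,
      ∃ f ∈ supportedOn k (deg (i + 1)) {b},
        z - boundary k (realize w (i + 1) f) ∈ boundaries k (belowComplex m (LowerSet.Iio b)) i

variable {deg : ∀ i, ι i → (Fin n →₀ ℕ)} {w : ∀ i, ι i → (Finset (Fin r) → k)}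

lemma realize_mem_chains {D : LowerSet (Fin n →₀ ℕ)} {i : ℕ}
    (hw : ∀ e, deg i e ∈ D → w i e ∈ chains k (belowComplex m (LowerSet.Iic (deg i e))) i)
    {f : ι i → k} (hf : f ∈ supportedOn k (deg i) D) :
    realize w i f ∈ chains k (belowComplex m D) i := by
  rw [Fintype.linearCombination_apply]
  refine Submodule.sum_mem _ fun e _ => ?_
  by_cases h0 : f e = 0
  · rw [h0, zero_smul]
    exact Submodule.zero_mem _
  · exact Submodule.smul_mem _ _ (chains_mono (belowComplex_mono (LowerSet.Iic_le.2 (hf e h0))) _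
      (hw e (hf e h0)))

lemma AdmissibleAt.realize_mem {D : LowerSet (Fin n →₀ ℕ)}
    (hD : ∀ b ∈ D, AdmissibleAt m deg w b) {i : ℕ} {f : ι i → k}
    (hf : f ∈ supportedOn k (deg i) D) : realize w i f ∈ chains k (belowComplex m D) i :=
  realize_mem_chains (fun e he => (hD _ he).carried i e rfl) hf

lemma singleton_subset_Iic (b : Fin n →₀ ℕ) :
    ({b} : Set (Fin n →₀ ℕ)) ⊆ (LowerSet.Iic b : LowerSet (Fin n →₀ ℕ)) := by
  rintro _ rfl
  exact LowerSet.mem_Iic_iff.2 le_rfl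

lemma AdmissibleAt.realize_mem_Iic {b : Fin n →₀ ℕ} (hb : AdmissibleAt m deg w b) {i : ℕ}
    {f : ι i → k} (hf : f ∈ supportedOn k (deg i) {b}) :
    realize w i f ∈ chains k (belowComplex m (LowerSet.Iic b)) i := by
  rw [Fintype.linearCombination_apply]
  refine Submodule.sum_mem _ fun e _ => ?_
  by_cases h0 : f e = 0
  · rw [h0, zero_smul]
    exact Submodule.zero_mem _
  · exact Submodule.smul_mem _ _ (hb.carried i e (hf e h0))

lemma AdmissibleAt.boundary_realize {b : Fin n →₀ ℕ} (hb : AdmissibleAt m deg w b) {i : ℕ}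
    {f : ι (i + 1) → k} (hf : f ∈ supportedOn k (deg (i + 1)) {b}) :
    ∃ g ∈ supportedOn k (deg i) (Set.Iio b), realize w i g = boundary k (realize w (i + 1) f) := by
  have : boundary k (realize w (i + 1) f) ∈
      (supportedOn k (deg i) (Set.Iio b)).map (realize w i) := by
    rw [Fintype.linearCombination_apply, map_sum]
    refine Submodule.sum_mem _ fun e _ => ?_
    by_cases h0 : f e = 0
    · rw [h0, zero_smul, map_zero]
      exact Submodule.zero_mem _
    · rw [map_smul]
      exact Submodule.smul_mem _ _ (hb.bdry i e (hf e h0))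
  exact this

/-- If no set of generators has lcm equal to the degree, the chain itself already lies strictly
below that degree. Its boundary is then null-homologous there, against independence. -/
lemma AdmissibleAt.mem_lcm {i : ℕ} {e : ι (i + 1)} (h : AdmissibleAt m deg w (deg (i + 1) e)) :
    ∃ A : Finset (Fin r), A.sup m = deg (i + 1) e := by
  by_contra! hA
  have h1 : (Pi.single e 1 : ι (i + 1) → k) ∈ supportedOn k (deg (i + 1)) {deg (i + 1) e} := by
    intro e' he'
    obtain rfl : e' = e := by
      by_contra hne
      exact he' (Pi.single_eq_of_ne hne _)
    rfl
  have h2 := h.indep i (Pi.single e 1) h1 ⟨_, mem_chains_Iio (h.realize_mem_Iic h1)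
    (fun A hA' => absurd hA' (hA A)), rfl⟩
  simpa using congrFun h2 e

lemma Grounded.realize_zero (h : Grounded deg w) (f : ι 0 → k) :
    ∃ e₀ : ι 0, (∀ e, e = e₀) ∧ deg 0 e₀ = 0 ∧ realize w 0 f = f e₀ • Pi.single ∅ 1 := by
  obtain ⟨e₀, h1, h2, h3⟩ := h
  refine ⟨e₀, h1, h2, ?_⟩
  rw [Fintype.linearCombination_apply, Finset.sum_eq_single e₀, h3]
  · exact fun e _ he => absurd (h1 e) he
  · exact fun he => absurd (Finset.mem_univ _) he

lemma Grounded.exists_realize_eq (h : Grounded deg w) {D : LowerSet (Fin n →₀ ℕ)}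
    {t : Finset (Fin r) → k} (ht : t ∈ chains k (belowComplex m D) 0) :
    ∃ f ∈ supportedOn k (deg 0) D, t = realize w 0 f := by
  obtain ⟨e₀, h1, h2, h3⟩ := h.realize_zero fun _ => t ∅
  refine ⟨fun _ => t ∅, fun e he => ?_, ?_⟩
  · rw [h1 e, h2]
    exact (ht ∅ he).1
  · rw [h3]
    exact eq_smul_of_mem_chains_zero ht

/-- In a relation of positive homological degree, take a maximal degree `b` that occurs. Faces with
lcm exactly `b` appear only in chains of degree `b`, so the degree `b` part of the relation is a
chain strictly below `b`, and independence kills it. -/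
lemma realize_injective (hG : Grounded deg w) {D : LowerSet (Fin n →₀ ℕ)}
    (hD : ∀ b ∈ D, AdmissibleAt m deg w b) {i : ℕ} {f : ι i → k}
    (hf : f ∈ supportedOn k (deg i) D) (h0 : realize w i f = 0) : f = 0 := by
  cases i with
  | zero =>
    obtain ⟨e₀, h1, h2, h3⟩ := hG.realize_zero f
    rw [h0] at h3
    have h4 : f e₀ = 0 := by simpa using (congrFun h3 ∅).symm
    ext e
    rw [h1 e, h4, Pi.zero_apply]
  | succ i =>
    by_contra hne
    obtain ⟨e₁, he₁⟩ := Function.ne_iff.1 hne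
    obtain ⟨b, hb⟩ := ((Set.toFinite {e | f e ≠ 0}).image (deg (i + 1))).exists_maximal
      ⟨_, e₁, he₁, rfl⟩
    obtain ⟨⟨e, he, rfl⟩, hmax⟩ := hb
    set b := deg (i + 1) e with hb
    have hAb := hD b (hf e he)
    have hp := degreePart_mem (k := k) (deg (i + 1)) b f
    have hz := hAb.indep i _ hp ⟨_, mem_chains_Iio (hAb.realize_mem_Iic hp) ?_, rfl⟩
    · have := congrFun hz e
      rw [degreePart, if_pos rfl] at this
      exact he this
    · intro A hA
      have h1 : realize w (i + 1) (degreePart (deg (i + 1)) b f) A = realize w (i + 1) f A := by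
        rw [Fintype.linearCombination_apply, Fintype.linearCombination_apply, Finset.sum_apply,
          Finset.sum_apply]
        refine Finset.sum_congr rfl fun e' _ => ?_
        rw [degreePart]
        split_ifs with h2
        · rfl
        · simp only [zero_smul, Pi.smul_apply]
          by_contra h3
          have h4 : f e' ≠ 0 := fun h => h3 (by rw [h, zero_smul])
          have h5 : w (i + 1) e' A ≠ 0 := fun h => h3 (by rw [h, smul_zero])
          have h6 : A.sup m ≤ deg (i + 1) e' :=
            ((hD _ (hf e' h4)).carried (i + 1) e' rfl A h5).1
          rw [hA] at h6
          exact h2 (le_antisymm (hmax ⟨e', h4, rfl⟩ h6) h6)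
      rw [h1, h0, Pi.zero_apply]

/-- The chains in degrees `D` modulo the span of the `w` in degrees `D` form an acyclic complex. -/
lemma exists_realize_add_boundary (hm : ∀ j, m j ≠ 0) (hG : Grounded deg w)
    (D : LowerSet (Fin n →₀ ℕ)) (hD : ∀ b ∈ D, AdmissibleAt m deg w b) {i : ℕ}
    {t : Finset (Fin r) → k} (ht : t ∈ chains k (belowComplex m D) (i + 1)) {f : ι i → k}
    (hf : f ∈ supportedOn k (deg i) D) (htf : boundary k t = realize w i f) :
    ∃ g ∈ supportedOn k (deg (i + 1)) D, ∃ s ∈ chains k (belowComplex m D) (i + 2),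
      t = realize w (i + 1) g + boundary k s := by
  induction hN : {b : LcmLattice m | b.1 ∈ D}.ncard using Nat.strong_induction_on
    generalizing D t f with
  | _ N ih =>
    subst hN
    by_cases ht0 : t = 0
    · exact ⟨0, Submodule.zero_mem _, 0, Submodule.zero_mem _, by simp [ht0]⟩
    obtain ⟨A₀, hA₀⟩ := Function.ne_iff.1 ht0
    -- Induction on the number of lattice elements in `D`: peel off a maximal one, `b`, and work in
    -- the lower set `D'` of degrees in `D` that are not multiples of `b`.
    obtain ⟨b, hbD, hmax⟩ := (Set.toFinite {b : LcmLattice m | b.1 ∈ D}).exists_maximal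
      ⟨⟨A₀.sup m, A₀, rfl⟩, (ht A₀ hA₀).1⟩
    have hmax' : ∀ x ∈ D, (∃ A : Finset (Fin r), A.sup m = x) → b.1 ≤ x → x = b.1 :=
      fun x hx hA hbx => le_antisymm (hmax (y := ⟨x, hA⟩) hx hbx) hbx
    have hAb := hD _ hbD
    let D' : LowerSet (Fin n →₀ ℕ) :=
      ⟨{x | x ∈ D ∧ ¬ b.1 ≤ x}, fun x y hyx hx => ⟨D.lower hyx hx.1, fun h => hx.2 (h.trans hyx)⟩⟩
    have hD'D : D' ≤ D := fun x hx => hx.1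
    have hlt : LowerSet.Iio b.1 ≤ D' := fun x hx =>
      ⟨D.lower (LowerSet.mem_Iio_iff.1 hx).le hbD, (LowerSet.mem_Iio_iff.1 hx).not_ge⟩
    have hle : LowerSet.Iic b.1 ≤ D := LowerSet.Iic_le.2 hbD
    have hcard : {b : LcmLattice m | b.1 ∈ D'}.ncard < {b : LcmLattice m | b.1 ∈ D}.ncard := by
      refine Set.ncard_lt_ncard (Set.ssubset_iff_exists.2 ⟨fun x hx => hx.1, b, hbD, ?_⟩)
      exact fun h => h.2 le_rfl
    set tb : Finset (Fin r) → k := fun A => if A.sup m = b.1 then t A else 0 with htb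
    have htb_mem : tb ∈ chains k (belowComplex m (LowerSet.Iic b.1)) (i + 1) := by
      intro A hA
      rw [htb] at hA
      dsimp only at hA
      split_ifs at hA with h
      · exact ⟨h.le, (ht A hA).2⟩
      · exact absurd rfl hA
    have ht' : t - tb ∈ chains k (belowComplex m D') (i + 1) := by
      intro A hA
      rw [Pi.sub_apply, htb] at hA
      dsimp only at hA
      split_ifs at hA with h
      · exact absurd (sub_self _) hA
      · rw [sub_zero] at hA
        exact ⟨⟨(ht A hA).1, fun hb => h (hmax' _ (ht A hA).1 ⟨A, rfl⟩ hb)⟩, (ht A hA).2⟩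
    have hfb := degreePart_mem (k := k) (deg i) b.1 f
    have hf' : f - degreePart (deg i) b.1 f ∈ supportedOn k (deg i) D' := by
      refine sub_degreePart_mem hf fun e he hne => ⟨he, fun hbe => hne ?_⟩
      cases i with
      | zero =>
        rw [hG.deg_zero] at hbe ⊢
        exact (le_antisymm hbe zero_le).symm
      | succ i => exact hmax' _ he (hD _ he).mem_lcm hbe
    -- Both `tb` and the degree `b` part of `f` live below `b`. The identity for `boundary k t` also
    -- equates this difference with a chain in `D'`, so no face with lcm exactly `b` can occur.
    have hu : realize w i (degreePart (deg i) b.1 f) - boundary k tb ∈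
        chains k (belowComplex m (LowerSet.Iio b.1)) i := by
      refine mem_chains_Iio (Submodule.sub_mem _ (hAb.realize_mem_Iic hfb)
        (boundary_mem_chains htb_mem)) fun A hA => ?_
      have h1 : realize w i (degreePart (deg i) b.1 f) - boundary k tb =
          boundary k (t - tb) - realize w i (f - degreePart (deg i) b.1 f) := by
        rw [map_sub, map_sub, htf]
        abel
      have h2 := Submodule.sub_mem _ (boundary_mem_chains ht')
        (AdmissibleAt.realize_mem (fun x hx => hD x (hD'D hx)) hf')
      rw [← h1] at h2
      by_contra h3
      exact (h2 A h3).1.2 hA.ge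
    have hfb0 : degreePart (deg i) b.1 f = 0 := by
      cases i with
      | zero =>
        by_contra hne
        obtain ⟨e, he⟩ := Function.ne_iff.1 hne
        -- A nonzero coefficient in `F₀` would force `b = 0`. By maximality every face in `D` would
        -- then have lcm `1`, but `t` involves a vertex and no generator is `1`.
        have hb0 : (0 : Fin n →₀ ℕ) = b.1 := (hG.deg_zero e).symm.trans (hfb e he)
        obtain ⟨h1, h2⟩ := ht A₀ hA₀
        obtain ⟨a, ha⟩ := Finset.card_pos.1 (h2 ▸ Nat.succ_pos 0 : 0 < A₀.card)
        have h3 := hmax' _ h1 ⟨A₀, rfl⟩ (hb0 ▸ zero_le)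
        rw [← hb0] at h3
        exact hm a (le_antisymm (h3 ▸ Finset.le_sup (f := m) ha) zero_le)
      | succ i =>
        refine hAb.indep i _ hfb ⟨_, hu, ?_⟩
        rw [map_sub, boundary_boundary, sub_zero]
    rw [hfb0, map_zero, zero_sub] at hu
    rw [hfb0, sub_zero] at hf'
    obtain ⟨h, hh, s, hs, hsz⟩ := hAb.spans b.2 i (boundary k tb)
      ⟨neg_mem_iff.1 hu, boundary_boundary _⟩
    -- The boundary of `tb` agrees with that of `realize h + s`, where `h` has degree `b` and `s`
    -- lies strictly below `b`. The difference is a cycle in the whole simplex below `b`, hence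
    -- bounds a cone; what remains, `t - tb + s`, lives in `D'`.
    have hy : tb - realize w (i + 1) h - s ∈
        cycles k (belowComplex m (LowerSet.Iic b.1)) (i + 1) := by
      refine ⟨Submodule.sub_mem _ (Submodule.sub_mem _ htb_mem (hAb.realize_mem_Iic hh))
        (chains_mono (belowComplex_mono (Iio_le_Iic _)) _ hs), ?_⟩
      exact LinearMap.mem_ker.2 (by rw [map_sub, map_sub, hsz, sub_self])
    obtain ⟨f₁, hf₁, hf₁h⟩ := hAb.boundary_realize hh
    obtain ⟨g, hg, s', hs', hgs⟩ := ih _ hcard D' (fun x hx => hD x (hD'D hx))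
      (t := t - tb + s)
      (Submodule.add_mem _ ht' (chains_mono (belowComplex_mono hlt) _ hs)) (f := f - f₁)
      (Submodule.sub_mem _ hf' (supportedOn_mono hlt hf₁))
      (by rw [map_add, map_sub, map_sub, htf, hsz, hf₁h]; abel) rfl
    refine ⟨h + g, Submodule.add_mem _ (supportedOn_mono ((singleton_subset_Iic _).trans hle) hh)
      (supportedOn_mono hD'D hg), apexCone k m b.1 (tb - realize w (i + 1) h - s) + s',
      Submodule.add_mem _ (chains_mono (belowComplex_mono hle) _ (apexCone_mem hy.1))
        (chains_mono (belowComplex_mono hD'D) _ hs'), ?_⟩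
    rw [map_add, map_add, boundary_apexCone_succ hy,
      show t = t - tb + s + (tb - s) by abel, hgs]
    abel

end Frames

/-! ### Multigraded strands and dehomogenization -/

section Homogenization

open MvPolynomial

variable {k : Type u} [Field k] {n : ℕ}

/-- The dehomogenization of the component of degree `β` of a vector of polynomials. -/
def component {X : Type*} (δ : X → (Fin n →₀ ℕ)) (β : Fin n →₀ ℕ)
    (f : X → MvPolynomial (Fin n) k) : X → k :=
  fun a => if δ a ≤ β then coeff (β - δ a) (f a) else 0

/-- The homogeneous vector of degree `β` with given coefficients. -/
def homogenize {X : Type*} (δ : X → (Fin n →₀ ℕ)) (β : Fin n →₀ ℕ) (g : X → k) :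
    X → MvPolynomial (Fin n) k :=
  fun a => monomial (β - δ a) (g a)

section

variable {X : Type*} {δ : X → (Fin n →₀ ℕ)}

lemma component_mem (β : Fin n →₀ ℕ) (f : X → MvPolynomial (Fin n) k) :
    component δ β f ∈ supportedOn k δ (LowerSet.Iic β : LowerSet (Fin n →₀ ℕ)) := by
  intro a ha
  by_contra h
  exact ha (if_neg h)

lemma component_homogenize {β : Fin n →₀ ℕ} {g : X → k}
    (hg : g ∈ supportedOn k δ (LowerSet.Iic β : LowerSet (Fin n →₀ ℕ))) :
    component δ β (homogenize δ β g) = g := by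
  ext a
  rw [component, homogenize]
  split_ifs with h
  · rw [coeff_monomial, if_pos rfl]
  · by_contra h0
    exact h (hg a (Ne.symm h0))

lemma eq_of_component {f f' : X → MvPolynomial (Fin n) k}
    (h : ∀ β, component δ β f = component δ β f') : f = f' := by
  ext a u
  have := congrFun (h (u + δ a)) a
  rwa [component, component, if_pos le_add_self, if_pos le_add_self, add_tsub_cancel_right] at this

lemma exists_sum_homogenize [Fintype X] (δ : X → (Fin n →₀ ℕ))
    (f : X → MvPolynomial (Fin n) k) :
    ∃ s : Finset (Fin n →₀ ℕ), f = ∑ β ∈ s, homogenize δ β (component δ β f) := by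
  refine ⟨Finset.univ.biUnion fun a => (f a).support.image (· + δ a), ?_⟩
  ext a u
  rw [Finset.sum_apply, coeff_sum, Finset.sum_eq_single (u + δ a)]
  · rw [homogenize, component, if_pos le_add_self, coeff_monomial, if_pos (by simp)]
    simp
  · intro β _ hβ
    rw [homogenize, component]
    split_ifs with h
    · rw [coeff_monomial, if_neg]
      rintro rfl
      exact hβ (tsub_add_cancel_of_le h).symm
    · simp
  · intro h
    rw [homogenize, component, if_pos le_add_self, coeff_monomial, if_pos (by simp),
      add_tsub_cancel_right]
    by_contra h0
    refine h (Finset.mem_biUnion.2 ⟨a, Finset.mem_univ _, Finset.mem_image.2 ⟨u, ?_, rfl⟩⟩)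
    exact mem_support_iff.2 h0

end

namespace MultigradedSeq

variable (F : MultigradedSeq k n)

/-- The matrix of coefficients of `F_{i+1} → F_i`. -/
def coef (i : ℕ) : Matrix (F.ι i) (F.ι (i + 1)) k :=
  fun a b => coeff (F.deg (i + 1) b - F.deg i a) (F.d i a b)

/-- The dehomogenization of the map `F_{i+1} → F_i`. -/
def dehom (i : ℕ) : (F.ι (i + 1) → k) →ₗ[k] (F.ι i → k) :=
  (F.coef i).mulVecLin

variable {F}

lemma d_eq (i : ℕ) (a : F.ι i) (b : F.ι (i + 1)) :
    F.d i a b = monomial (F.deg (i + 1) b - F.deg i a) (F.coef i a b) := by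
  rcases F.multigraded i a b with h | ⟨_, t, h⟩
  · rw [coef, h, coeff_zero, map_zero]
  · rw [coef, h, coeff_monomial, if_pos rfl]

lemma deg_le_of_coef {i : ℕ} {a : F.ι i} {b : F.ι (i + 1)} (h : F.coef i a b ≠ 0) :
    F.deg i a ≤ F.deg (i + 1) b := by
  rcases F.multigraded i a b with h0 | h0
  · exact absurd (by rw [coef, h0, coeff_zero]) h
  · exact h0.1

lemma dehom_apply (i : ℕ) (f : F.ι (i + 1) → k) (a : F.ι i) :
    F.dehom i f a = ∑ b, F.coef i a b * f b :=
  rfl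

lemma map_apply (i : ℕ) (f : F.ι (i + 1) → MvPolynomial (Fin n) k) (a : F.ι i) :
    F.map i f a = ∑ b, F.d i a b * f b :=
  rfl

lemma component_map (i : ℕ) (β : Fin n →₀ ℕ) (f : F.ι (i + 1) → MvPolynomial (Fin n) k) :
    component (F.deg i) β (F.map i f) = F.dehom i (component (F.deg (i + 1)) β f) := by
  ext a
  rw [component, dehom_apply, map_apply]
  split_ifs with h
  · rw [coeff_sum]
    refine Finset.sum_congr rfl fun b _ => ?_
    rw [d_eq, coeff_monomial_mul', component]
    by_cases hc : F.coef i a b = 0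
    · simp [hc]
    · have hab := deg_le_of_coef hc
      rw [tsub_tsub_tsub_cancel_right hab]
      by_cases hb : F.deg (i + 1) b ≤ β
      · rw [if_pos hb, if_pos (tsub_le_tsub_right hb _)]
      · rw [if_neg hb, if_neg (mt (tsub_le_tsub_iff_right h).1 hb), mul_zero]
  · refine (Finset.sum_eq_zero fun b _ => ?_).symm
    by_contra h0
    have hab := deg_le_of_coef (left_ne_zero_of_mul h0)
    exact h (hab.trans (component_mem β f b (right_ne_zero_of_mul h0)))

lemma map_homogenize (i : ℕ) {β : Fin n →₀ ℕ} {g : F.ι (i + 1) → k}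
    (hg : g ∈ supportedOn k (F.deg (i + 1)) (LowerSet.Iic β : LowerSet (Fin n →₀ ℕ))) :
    F.map i (homogenize (F.deg (i + 1)) β g) = homogenize (F.deg i) β (F.dehom i g) := by
  ext1 a
  rw [map_apply, homogenize, dehom_apply, map_sum]
  refine Finset.sum_congr rfl fun b _ => ?_
  rw [d_eq, homogenize, monomial_mul]
  by_cases hc : F.coef i a b = 0
  · simp [hc]
  by_cases hb : g b = 0
  · simp [hb]
  have h2 : F.deg (i + 1) b ≤ β := hg b hb
  rw [add_comm, tsub_add_tsub_cancel h2 (deg_le_of_coef hc)]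

/-- The maps are multigraded, so exactness can be checked strand by strand. The strand in degree `β`
consists of the coefficient vectors supported on basis elements of degree dividing `β`, with the
same scalar matrix for all `β`. -/
lemma exact_iff_dehom (i : ℕ) : Function.Exact (F.map (i + 1)) (F.map i) ↔
    (∀ g, F.dehom i (F.dehom (i + 1) g) = 0) ∧
    ∀ β : Fin n →₀ ℕ,
      ∀ f ∈ supportedOn k (F.deg (i + 1)) (LowerSet.Iic β : LowerSet (Fin n →₀ ℕ)),
        F.dehom i f = 0 →
          ∃ g ∈ supportedOn k (F.deg (i + 2)) (LowerSet.Iic β : LowerSet (Fin n →₀ ℕ)),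
            F.dehom (i + 1) g = f := by
  constructor
  · intro h
    refine ⟨fun g => ?_, fun β f hf hf0 => ?_⟩
    -- In the degree given by the lcm of all basis degrees, every coefficient vector occurs in the
    -- strand.
    · have hg : g ∈ supportedOn k (F.deg (i + 2))
          (LowerSet.Iic (Finset.univ.sup (F.deg (i + 2))) : LowerSet (Fin n →₀ ℕ)) :=
        fun e _ => Finset.le_sup (f := F.deg (i + 2)) (Finset.mem_univ e)
      have h1 := h.apply_apply_eq_zero
        (homogenize (F.deg (i + 2)) (Finset.univ.sup (F.deg (i + 2))) g)
      have h2 := component_map i (Finset.univ.sup (F.deg (i + 2))) (F.map (i + 1)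
        (homogenize (F.deg (i + 2)) (Finset.univ.sup (F.deg (i + 2))) g))
      rw [h1, component_map, component_homogenize hg] at h2
      rw [← h2]
      ext a
      simp [component]
    · obtain ⟨g, hg⟩ := (h (homogenize (F.deg (i + 1)) β f)).1 (by
        rw [map_homogenize i hf, hf0]
        ext1 a
        simp [homogenize])
      refine ⟨component (F.deg (i + 2)) β g, component_mem β g, ?_⟩
      rw [← component_map, hg, component_homogenize hf]
  · rintro ⟨h1, h2⟩ f
    constructor
    · intro hf
      obtain ⟨s, hs⟩ := exists_sum_homogenize (F.deg (i + 1)) f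
      choose g hg hgf using fun β => h2 β (component (F.deg (i + 1)) β f) (component_mem β f) (by
        rw [← component_map, hf]
        ext a
        simp [component])
      refine ⟨∑ β ∈ s, homogenize (F.deg (i + 2)) β (g β), ?_⟩
      rw [map_sum]
      conv_rhs => rw [hs]
      exact Finset.sum_congr rfl fun β _ => by rw [map_homogenize (i + 1) (hg β), hgf]
    · rintro ⟨g, rfl⟩
      refine eq_of_component (δ := F.deg i) fun β => ?_
      rw [component_map, component_map, h1]
      ext a
      simp [component]

lemma monomial_mem_span_X {u : Fin n →₀ ℕ} {t : k} :
    monomial u t ∈ Ideal.span (Set.range (X (R := k) (σ := Fin n))) ↔ t = 0 ∨ u ≠ 0 := by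
  rw [← Set.image_univ, mem_ideal_span_X_image]
  constructor
  · intro h
    by_contra! hu
    obtain ⟨j, _, hj⟩ := h u (by simp [mem_support_iff, hu.1])
    exact hj (by rw [hu.2]; rfl)
  · rintro (rfl | hu) v hv
    · simp at hv
    · obtain rfl : v = u := by
        by_contra hne
        exact mem_support_iff.1 hv (by rw [coeff_monomial, if_neg (Ne.symm hne)])
      obtain ⟨j, hj⟩ := Finsupp.ne_iff.1 hu
      exact ⟨j, Set.mem_univ j, hj⟩

/-- Equal degrees would make the entry a nonzero constant, which is not in `(x₁, …, x_n)`. This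
turns minimality into strict inequality of degrees. -/
lemma deg_lt_of_coef {i : ℕ} {a : F.ι i} {b : F.ι (i + 1)}
    (hF : F.d i a b ∈ Ideal.span (Set.range (X (R := k) (σ := Fin n))))
    (h : F.coef i a b ≠ 0) : F.deg i a < F.deg (i + 1) b := by
  refine lt_of_le_of_ne (deg_le_of_coef h) fun heq => ?_
  rw [d_eq, monomial_mem_span_X, heq, tsub_self] at hF
  exact hF.elim h fun h => h rfl

end MultigradedSeq

end Homogenization

/-! ### Homology bases and the Mayer–Vietoris computation -/

section Classes

variable {k : Type u} [Field k] {n r : ℕ} {m : Fin r → (Fin n →₀ ℕ)}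

lemma chains_Iio_zero {c : ℕ} {f : Finset (Fin r) → k}
    (hf : f ∈ chains k (belowComplex m (LowerSet.Iio 0)) c) : f = 0 := by
  ext A
  by_contra hA
  exact not_lt_of_ge zero_le (LowerSet.mem_Iio_iff.1 (mem_belowComplex.1 (hf A hA).1))

/-- No face has lcm strictly dividing `1`, so the complex at the bottom element is void, without
even the empty face, and all its homology vanishes. -/
lemma ne_zero_of_nontrivial {b : LcmLattice m} {c : ℕ}
    (h : Nontrivial (RedHomology k (delta m b) c)) : b.1 ≠ 0 := by
  intro hb
  obtain ⟨x, hx⟩ := exists_ne (0 : RedHomology k (delta m b) c)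
  obtain ⟨⟨z, hz⟩, rfl⟩ := homologyClass_surjective _ _ x
  refine hx (homologyClass_eq_zero.2 ?_)
  have h1 := hz.1
  rw [delta_eq_belowComplex, hb] at h1
  obtain rfl := chains_Iio_zero h1
  exact Submodule.zero_mem _

lemma inclusionMap_homologyClass {Δ Δ' : LowerSet (Finset (Fin r))} (h : Δ ≤ Δ') (c : ℕ)
    (z : cycles k Δ c) : inclusionMap (k := k) h c (homologyClass k Δ c z) =
      homologyClass k Δ' c ⟨z.1, cycles_mono h c z.2⟩ :=
  rfl

lemma homologyClass_eq_iff {Δ : LowerSet (Finset (Fin r))} {c : ℕ} {z z' : cycles k Δ c} :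
    homologyClass k Δ c z = homologyClass k Δ c z' ↔ z.1 - z'.1 ∈ boundaries k Δ c := by
  rw [← sub_eq_zero, ← map_sub, homologyClass_eq_zero]
  rfl

variable {ι : ℕ → Type*} [∀ i, Fintype (ι i)]
  {deg : ∀ i, ι i → (Fin n →₀ ℕ)} {w : ∀ i, ι i → (Finset (Fin r) → k)}

lemma realize_degreePart (i : ℕ) (b : Fin n →₀ ℕ) (f : ι i → k) :
    realize w i (degreePart (deg i) b f) = ∑ a : {a // deg i a = b}, f a • w i a := by
  rw [Fintype.linearCombination_apply]
  simp only [degreePart, ite_smul, zero_smul]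
  rw [← Finset.sum_filter]
  exact Finset.sum_subtype _ (by simp) _

lemma boundary_mem_cycles_delta (hA : ∀ b, AdmissibleAt m deg w b) (b : LcmLattice m) (c : ℕ)
    (e : {e : ι (c + 1) // deg (c + 1) e = b.1}) :
    boundary k (w (c + 1) e) ∈ cycles k (delta m b) c := by
  refine ⟨?_, boundary_boundary _⟩
  obtain ⟨f, hf, hfe⟩ := (hA _).bdry c e e.2
  rw [← hfe, delta_eq_belowComplex]
  exact AdmissibleAt.realize_mem (fun b _ => hA b) hf

/-- The homology classes of the boundaries of the chains `w` of degree `b`. -/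
def bdryClass (hA : ∀ b, AdmissibleAt m deg w b) (b : LcmLattice m) (c : ℕ)
    (e : {e : ι (c + 1) // deg (c + 1) e = b.1}) : RedHomology k (delta m b) c :=
  homologyClass k (delta m b) c ⟨boundary k (w (c + 1) e), boundary_mem_cycles_delta hA b c e⟩

lemma sum_smul_bdryClass (hA : ∀ b, AdmissibleAt m deg w b) (b : LcmLattice m) (c : ℕ)
    (f : ι (c + 1) → k) (z : cycles k (delta m b) c)
    (hz : z.1 = boundary k (realize w (c + 1) (degreePart (deg (c + 1)) b.1 f))) :
    homologyClass k (delta m b) c z =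
      ∑ e : {e // deg (c + 1) e = b.1}, f e • bdryClass hA b c e := by
  simp only [bdryClass, ← map_smul, ← map_sum]
  congr 1
  ext1
  rw [hz, realize_degreePart, map_sum, Submodule.coe_sum]
  simp

/-- The extension by zero of a vector of coefficients in degree `b`. -/
def extendDegree {X : Type*} {δ : X → (Fin n →₀ ℕ)} {b : Fin n →₀ ℕ} (g : {e // δ e = b} → k) :
    X → k :=
  fun e => if h : δ e = b then g ⟨e, h⟩ else 0

lemma extendDegree_mem {X : Type*} {δ : X → (Fin n →₀ ℕ)} {b : Fin n →₀ ℕ}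
    (g : {e // δ e = b} → k) : extendDegree g ∈ supportedOn k δ {b} := by
  intro e he
  by_contra h
  exact he (dif_neg h)

lemma degreePart_eq_self {X : Type*} {δ : X → (Fin n →₀ ℕ)} {b : Fin n →₀ ℕ} {f : X → k}
    (hf : f ∈ supportedOn k δ {b}) : degreePart δ b f = f := by
  ext e
  rw [degreePart]
  split_ifs with h
  · rfl
  · by_contra h0
    exact h (hf e (Ne.symm h0))

lemma boundary_realize_mem_cycles (hA : ∀ b, AdmissibleAt m deg w b) (b : LcmLattice m) (c : ℕ)
    {f : ι (c + 1) → k} (hf : f ∈ supportedOn k (deg (c + 1)) {b.1}) :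
    boundary k (realize w (c + 1) f) ∈ cycles k (delta m b) c := by
  refine ⟨?_, boundary_boundary _⟩
  obtain ⟨g, hg, hgf⟩ := (hA _).boundary_realize hf
  rw [← hgf, delta_eq_belowComplex]
  exact AdmissibleAt.realize_mem (fun b _ => hA b) hg

/-- The classes of the boundaries of the chains `w` of degree `b` form a basis. -/
def classBasis (hA : ∀ b, AdmissibleAt m deg w b) (b : LcmLattice m) (c : ℕ) :
    Module.Basis {e : ι (c + 1) // deg (c + 1) e = b.1} k (RedHomology k (delta m b) c) :=
  Module.Basis.mk (v := bdryClass hA b c)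
    (by
      rw [Fintype.linearIndependent_iff]
      intro g hg e
      have hg' := extendDegree_mem g
      have h1 := sum_smul_bdryClass hA b c (extendDegree g)
        ⟨_, boundary_realize_mem_cycles hA b c hg'⟩ (by rw [degreePart_eq_self hg'])
      have h2 : ∀ e : {e : ι (c + 1) // deg (c + 1) e = b.1}, extendDegree g e.1 = g e :=
        fun e => dif_pos e.2
      simp only [h2] at h1
      rw [hg, homologyClass_eq_zero] at h1
      replace h1 : boundary k (realize w (c + 1) (extendDegree g)) ∈
        boundaries k (delta m b) c := h1
      rw [delta_eq_belowComplex] at h1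
      rw [← h2, (hA b.1).indep c _ hg' h1, Pi.zero_apply])
    (by
      rintro x -
      obtain ⟨⟨z, hz'⟩, rfl⟩ := homologyClass_surjective _ _ x
      have hz := hz'
      rw [delta_eq_belowComplex] at hz
      obtain ⟨f, hf, hzf⟩ := (hA b.1).spans b.2 c z hz
      rw [← delta_eq_belowComplex] at hzf
      have h1 := sum_smul_bdryClass hA b c f
        ⟨_, boundary_realize_mem_cycles hA b c hf⟩ (by rw [degreePart_eq_self hf])
      rw [(homologyClass_eq_iff (z' := ⟨_, boundary_realize_mem_cycles hA b c hf⟩)).2 hzf, h1]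
      exact Submodule.sum_mem _ fun e _ => Submodule.smul_mem _ _ (Submodule.subset_span ⟨e, rfl⟩))

lemma classBasis_apply (hA : ∀ b, AdmissibleAt m deg w b) (b : LcmLattice m) (c : ℕ)
    (e : {e : ι (c + 1) // deg (c + 1) e = b.1}) : classBasis hA b c e = bdryClass hA b c e := by
  rw [classBasis, Module.Basis.mk_apply]

/-- The basis classes in `H̃_{c-1}(Δ_b)` are indexed by the degree `b` basis elements of `F_{c+1}`.
The sets `𝓑_c` can thus be read off from the basis degrees. -/
lemma nontrivial_iff_exists_deg (hA : ∀ b, AdmissibleAt m deg w b) (b : LcmLattice m) (c : ℕ) :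
    Nontrivial (RedHomology k (delta m b) c) ↔ ∃ e, deg (c + 1) e = b.1 := by
  constructor
  · intro h
    obtain ⟨e⟩ := (classBasis hA b c).index_nonempty
    exact ⟨e.1, e.2⟩
  · rintro ⟨e, he⟩
    exact ⟨⟨_, _, (classBasis hA b c).ne_zero ⟨e, he⟩⟩⟩

lemma mem_bettiBelow_iff (hA : ∀ b, AdmissibleAt m deg w b) {b β : LcmLattice m} {c : ℕ} :
    β ∈ bettiBelow m k c b ↔ β < b ∧ ∃ e, deg (c + 1) e = β.1 := by
  rw [← nontrivial_iff_exists_deg hA]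
  exact ⟨fun h => ⟨h.2.2.1, h.2.2.2⟩,
    fun h => ⟨Or.inr ⟨c, h.2⟩, ne_zero_of_nontrivial h.2, h.1, h.2⟩⟩

lemma exists_topBelow (hA : ∀ b, AdmissibleAt m deg w b) {b : LcmLattice m} {c : ℕ}
    {a : ι (c + 1)} (ha : deg (c + 1) a < b.1) :
    ∃ γ ∈ topBelow m k c b, deg (c + 1) a ≤ γ.1 := by
  have h : (⟨deg (c + 1) a, (hA _).mem_lcm⟩ : LcmLattice m) ∈ bettiBelow m k c b :=
    (mem_bettiBelow_iff hA).2 ⟨ha, a, rfl⟩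
  obtain ⟨γ, h1, h2⟩ := (Set.toFinite (bettiBelow m k c b)).exists_le_maximal h
  exact ⟨γ, h2, h1⟩

lemma realize_mem_labelComplex (hA : ∀ b, AdmissibleAt m deg w b) {T : Set (LcmLattice m)} {i : ℕ}
    {f : ι i → k} (hf : ∀ a, f a ≠ 0 → ∃ γ ∈ T, deg i a ≤ γ.1) :
    realize w i f ∈ chains k (labelComplex m T) i := by
  rw [Fintype.linearCombination_apply]
  refine Submodule.sum_mem _ fun a _ => ?_
  by_cases h0 : f a = 0
  · rw [h0, zero_smul]
    exact Submodule.zero_mem _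
  · obtain ⟨γ, hγ, haγ⟩ := hf a h0
    refine Submodule.smul_mem _ _ fun A hA' => ?_
    obtain ⟨h1, h2⟩ := (hA _).carried i a rfl A hA'
    exact ⟨mem_labelComplex.2 ⟨γ, hγ, subset_label.2 (le_trans h1 haγ)⟩, h2⟩

/-- Every basis degree strictly below `b` lies under a maximal element of `𝓑_c(b)`. Consequently
boundaries of chains of degree `b` are cycles in `Δ_b^{(c)}` and furnish the preimages `[g_j]`. -/
lemma realize_mem_deltaSub (hA : ∀ b, AdmissibleAt m deg w b) {b : LcmLattice m} {c : ℕ}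
    {f : ι (c + 1) → k} (hf : f ∈ supportedOn k (deg (c + 1)) (Set.Iio b.1)) :
    realize w (c + 1) f ∈ chains k (deltaSub m k c b) (c + 1) :=
  realize_mem_labelComplex hA fun a ha => exists_topBelow hA (hf a ha)

lemma mvMap_realize (hA : ∀ b, AdmissibleAt m deg w b) {b γ : LcmLattice m} {c : ℕ}
    (hγ : γ ∈ topBelow m k c b)
    {f : ι (c + 1) → k} (hf : f ∈ supportedOn k (deg (c + 1)) (Set.Iio b.1))
    (z : cycles k (deltaSub m k c b) (c + 1)) (hz : z.1 = realize w (c + 1) f) :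
    mvMap k hγ (homologyClass k _ _ z) =
      ∑ e : {e // deg (c + 1) e = γ.1}, f e • bdryClass hA γ c e := by
  -- The Mayer–Vietoris decomposition is made on coefficients: `c₁` collects the terms of degree at
  -- most `γ`, and `c₂ = c₁ - f` consists of terms under other maximal elements.
  set f₁ : ι (c + 1) → k := fun a => if deg (c + 1) a ≤ γ.1 then f a else 0 with hf₁
  have h₁ : realize w (c + 1) f₁ ∈ chains k (labelComplex m {γ}) (c + 1) := by
    refine realize_mem_labelComplex hA fun a ha => ⟨γ, rfl, ?_⟩
    by_contra h
    exact ha (if_neg h)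
  have h₂ : realize w (c + 1) (f₁ - f) ∈
      chains k (labelComplex m (topBelow m k c b \ {γ})) (c + 1) := by
    refine realize_mem_labelComplex hA fun a ha => ?_
    have hn : ¬ deg (c + 1) a ≤ γ.1 := fun h => ha (by rw [Pi.sub_apply, hf₁]; simp [h])
    have h0 : f a ≠ 0 := fun h => ha (by rw [Pi.sub_apply, hf₁]; simp [h])
    obtain ⟨γ', h1, h2⟩ := exists_topBelow hA (hf a h0)
    refine ⟨γ', ⟨h1, ?_⟩, h2⟩
    rintro rfl
    exact hn h2
  have hb : boundary k (realize w (c + 1) f₁) = boundary k (realize w (c + 1) (f₁ - f)) := by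
    have := LinearMap.mem_ker.1 z.2.2
    rw [hz] at this
    rw [map_sub, map_sub, this, sub_zero]
  have hz₁ : boundary k (realize w (c + 1) f₁) ∈
      cycles k (labelComplex m {γ} ⊓ labelComplex m (topBelow m k c b \ {γ})) c := by
    refine ⟨fun A hA' => ?_, boundary_boundary _⟩
    have h3 := boundary_mem_chains h₁ A hA'
    rw [hb] at hA'
    exact ⟨⟨h3.1, (boundary_mem_chains h₂ A hA').1⟩, h3.2⟩
  change inclusionMap (k := k) (inter_le_delta k hγ) c (connecting (k := k) (Δ := deltaSub m k c b)
    (labelComplex_split hγ) c (homologyClass k (deltaSub m k c b) (c + 1) z)) = _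
  rw [connecting_eq (Δ := deltaSub m k c b) (labelComplex_split hγ) c z _ _ h₁ h₂
    (by rw [hz, ← map_sub, sub_sub_cancel]) ⟨_, hz₁⟩ rfl, inclusionMap_homologyClass,
    ← sum_smul_bdryClass hA γ c f
      ⟨_, boundary_realize_mem_cycles hA γ c (degreePart_mem _ γ.1 f)⟩ rfl,
    homologyClass_eq_iff, ← map_sub, ← map_sub, delta_eq_belowComplex]
  -- The terms of `f₁` of degree strictly below `γ` form a chain in `Δ_γ`, so their boundary is zero
  -- in homology and only the part of degree exactly `γ` counts.
  refine ⟨_, AdmissibleAt.realize_mem (fun b _ => hA b) fun a ha => ?_, rfl⟩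
  rw [Pi.sub_apply, hf₁, degreePart] at ha
  refine LowerSet.mem_Iio_iff.2 (lt_of_le_of_ne ?_ fun h => ha ?_)
  · by_contra h
    refine ha ?_
    rw [if_neg fun h' => h h'.le]
    simp [h]
  · simp [h]

end Classes

/-! ### The maximal approximation agrees with the Mayer–Vietoris differentials -/

section Comparison

open MvPolynomial

variable {k : Type u} [Field k] {n r : ℕ} {m : Fin r → (Fin n →₀ ℕ)}

lemma MultigradedSeq.Equal.symm {F G : MultigradedSeq k n} (h : F.Equal G) : G.Equal F := by
  obtain ⟨e, h1, h2⟩ := h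
  refine ⟨fun i => (e i).symm, fun i a => ?_, fun i a b => ?_⟩
  · rw [← h1, Equiv.apply_symm_apply]
  · rw [← h2, Equiv.apply_symm_apply, Equiv.apply_symm_apply]

variable {F : MultigradedSeq k n} {w : ∀ i, F.ι i → (Finset (Fin r) → k)}

lemma deg_ne_zero (hA : ∀ b, AdmissibleAt m F.deg w b) {c : ℕ} (a : F.ι (c + 1)) :
    F.deg (c + 1) a ≠ 0 :=
  ne_zero_of_nontrivial ((nontrivial_iff_exists_deg hA ⟨_, (hA _).mem_lcm⟩ c).2 ⟨a, rfl⟩)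

/-- The fibres of the degree map are the fibres of its corestriction to `L_M \ {1}`. -/
def degreeIndexEquiv (hA : ∀ b, AdmissibleAt m F.deg w b) (hG : Grounded F.deg w)
    (σ : ∀ (b : LcmLattice m) (c : ℕ), Fin (Module.finrank k (RedHomology k (delta m b) c)) ≃
      {a : F.ι (c + 1) // F.deg (c + 1) a = b.1}) : ∀ i, F.ι i ≃ GIndex k m i
  | 0 =>
    { toFun := fun _ => ()
      invFun := fun _ => hG.choose
      left_inv := fun e => (hG.choose_spec.1 e).symm
      right_inv := fun _ => rfl }
  | c + 1 =>
    (Equiv.sigmaFiberEquiv fun a : F.ι (c + 1) =>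
      (⟨⟨F.deg (c + 1) a, (hA _).mem_lcm⟩, deg_ne_zero hA a⟩ :
        {b : LcmLattice m // b.1 ≠ 0})).symm.trans
    (Equiv.sigmaCongrRight fun b =>
      (Equiv.subtypeEquivRight fun a => by rw [Subtype.ext_iff, Subtype.ext_iff]).trans
        (σ b.1 c).symm)

lemma degreeIndexEquiv_symm (hA : ∀ b, AdmissibleAt m F.deg w b) (hG : Grounded F.deg w)
    (σ : ∀ (b : LcmLattice m) (c : ℕ), Fin (Module.finrank k (RedHomology k (delta m b) c)) ≃
      {a : F.ι (c + 1) // F.deg (c + 1) a = b.1}) (c : ℕ) (b : {b : LcmLattice m // b.1 ≠ 0})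
    (j : Fin (Module.finrank k (RedHomology k (delta m b.1) c))) :
    (degreeIndexEquiv hA hG σ (c + 1)).symm ⟨b, j⟩ = (σ b.1 c j).1 :=
  rfl

/-- The matrix entries of the maximal approximation are the coefficients of `ψ`. -/
lemma toMatrix_psi (hA : ∀ b, AdmissibleAt m F.deg w b)
    (hbd : ∀ i e, boundary k (w (i + 1) e) = realize w i fun a => F.coef i a e)
    (hlt : ∀ i a b, F.coef i a b ≠ 0 → F.deg i a < F.deg (i + 1) b)
    (C : Choices k m)
    (σ : ∀ (b : LcmLattice m) (c : ℕ), Fin (Module.finrank k (RedHomology k (delta m b) c)) ≃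
      {a : F.ι (c + 1) // F.deg (c + 1) a = b.1})
    (hbasis : ∀ b c j, C.basis b c j = bdryClass hA b c (σ b c j))
    (hlift : ∀ b c j, ∃ z : cycles k (deltaSub m k c b) (c + 1),
      z.1 = boundary k (w (c + 2) (σ b (c + 1) j)) ∧ C.lift b c j = homologyClass k _ _ z)
    (c : ℕ) (β γ : LcmLattice m) (i j) :
    LinearMap.toMatrix (C.basis β (c + 1)) (C.basis γ c) (C.psi c β γ) i j =
      if ∃ a', γ.1 < F.deg (c + 1) a' ∧ F.deg (c + 1) a' < β.1 then 0 else
        F.coef (c + 1) (σ γ c i).1 (σ β (c + 1) j).1 := by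
  rw [LinearMap.toMatrix_apply, Choices.psi]
  set a := σ γ c i with ha
  set e := σ β (c + 1) j with he
  have hsupp : (fun a => F.coef (c + 1) a e.1) ∈ supportedOn k (F.deg (c + 1)) (Set.Iio β.1) :=
    fun a' ha' => (hlt _ _ _ ha').trans_eq e.2
  by_cases hγ : γ ∈ topBelow m k c β
  · rw [dif_pos hγ, Module.Basis.constr_basis, if_neg]
    · obtain ⟨z, hz, hCz⟩ := hlift β c j
      rw [hCz, mvMap_realize hA hγ hsupp z (hz.trans (hbd _ _)), ← Equiv.sum_comp (σ γ c)]
      simp only [← hbasis]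
      rw [Module.Basis.repr_sum_self]
    -- A basis degree strictly between `γ` and `β` would be an element of `𝓑_c(β)` above the maximal
    -- `γ`.
    · rintro ⟨a', h1, h2⟩
      have h3 := hγ.2 (y := ⟨_, (hA _).mem_lcm⟩)
        ((mem_bettiBelow_iff hA).2 ⟨h2, a', rfl⟩) (le_of_lt h1)
      exact h1.not_ge h3
  · rw [dif_neg hγ, LinearMap.zero_apply, map_zero, Finsupp.zero_apply]
    split_ifs with h
    · rfl
    -- A nonzero coefficient puts `γ` strictly below `β`, hence under some maximal `γ'`. As `γ` is
    -- not maximal, `γ'` is strictly larger, and a basis element of degree `γ'` forces the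
    -- approximation to delete the entry.
    · by_contra h0
      have h1 : γ.1 < β.1 := a.2 ▸ hsupp a.1 (Ne.symm h0)
      obtain ⟨γ', h2, h3⟩ := exists_topBelow hA (b := β) (hsupp a.1 (Ne.symm h0))
      obtain ⟨h4, a', h5⟩ := (mem_bettiBelow_iff hA).1 h2.1
      refine h ⟨a', ?_, h5 ▸ h4⟩
      rw [h5]
      refine lt_of_le_of_ne (a.2 ▸ h3) fun h6 => hγ ?_
      rwa [Subtype.ext h6]

/-- The common endpoint of both directions: it needs only an admissible family whose boundaries
represent the chosen bases and preimages, regardless of whether the resolution or the choices came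
first. -/
theorem approx_equal_G (hG : Grounded F.deg w) (hA : ∀ b, AdmissibleAt m F.deg w b)
    (hbd : ∀ i e, boundary k (w (i + 1) e) = realize w i fun a => F.coef i a e)
    (hlt : ∀ i a b, F.coef i a b ≠ 0 → F.deg i a < F.deg (i + 1) b)
    (hone : ∀ a b, F.coef 0 a b = 1) (C : Choices k m)
    (σ : ∀ (b : LcmLattice m) (c : ℕ), Fin (Module.finrank k (RedHomology k (delta m b) c)) ≃
      {a : F.ι (c + 1) // F.deg (c + 1) a = b.1})
    (hbasis : ∀ b c j, C.basis b c j = bdryClass hA b c (σ b c j))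
    (hlift : ∀ b c j, ∃ z : cycles k (deltaSub m k c b) (c + 1),
      z.1 = boundary k (w (c + 2) (σ b (c + 1) j)) ∧ C.lift b c j = homologyClass k _ _ z) :
    F.approx.Equal C.G := by
  have key : ∀ i (a : F.ι i) (b : F.ι (i + 1)),
      C.G.d i (degreeIndexEquiv hA hG σ i a) (degreeIndexEquiv hA hG σ (i + 1) b) =
        if ∃ a', F.deg i a < F.deg i a' ∧ F.deg i a' < F.deg (i + 1) b then 0 else F.d i a b := by
    intro i a b
    rw [F.d_eq]
    cases i with
    | zero =>
      rw [if_neg, hG.deg_zero, tsub_zero, hone]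
      · rfl
      · rintro ⟨a', h1, -⟩
        rw [hG.deg_zero, hG.deg_zero] at h1
        exact lt_irrefl _ h1
    | succ c =>
      obtain ⟨x, rfl⟩ := (degreeIndexEquiv hA hG σ (c + 1)).symm.surjective a
      obtain ⟨y, rfl⟩ := (degreeIndexEquiv hA hG σ (c + 2)).symm.surjective b
      rw [(degreeIndexEquiv hA hG σ (c + 1)).apply_symm_apply,
        (degreeIndexEquiv hA hG σ (c + 2)).apply_symm_apply]
      obtain ⟨γ, i⟩ := x
      obtain ⟨β, j⟩ := y
      rw [degreeIndexEquiv_symm, degreeIndexEquiv_symm, (σ γ.1 c i).2, (σ β.1 (c + 1) j).2]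
      change monomial (β.1.1 - γ.1.1) _ = _
      rw [toMatrix_psi hA hbd hlt C σ hbasis hlift]
      split_ifs <;> simp
  refine ⟨degreeIndexEquiv hA hG σ, fun i a => ?_, key⟩
  cases i with
  | zero => exact (hG.deg_zero a).symm
  | succ c => rfl

end Comparison

/-! ### From a minimal resolution to choices -/

section FromResolution

open MvPolynomial

variable {k : Type u} [Field k] {n r : ℕ} {m : Fin r → (Fin n →₀ ℕ)}

lemma boundary_realize_dehom {F : MultigradedSeq k n} {w : ∀ i, F.ι i → (Finset (Fin r) → k)}
    {i : ℕ} (hbd : ∀ e, boundary k (w (i + 1) e) = realize w i fun a => F.coef i a e)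
    (f : F.ι (i + 1) → k) :
    boundary k (realize w (i + 1) f) = realize w i (F.dehom i f) := by
  simp only [Fintype.linearCombination_apply, map_sum, map_smul, hbd, F.dehom_apply,
    Finset.smul_sum, Finset.sum_smul]
  rw [Finset.sum_comm]
  simp only [smul_smul, mul_comm]

lemma dehom_mem {F : MultigradedSeq k n} {i : ℕ}
    (hlt : ∀ a b, F.coef i a b ≠ 0 → F.deg i a < F.deg (i + 1) b) {β : Fin n →₀ ℕ}
    {f : F.ι (i + 1) → k}
    (hf : f ∈ supportedOn k (F.deg (i + 1)) (LowerSet.Iic β : LowerSet (Fin n →₀ ℕ))) :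
    F.dehom i f ∈ supportedOn k (F.deg i) (LowerSet.Iio β : LowerSet (Fin n →₀ ℕ)) := by
  intro a ha
  rw [F.dehom_apply] at ha
  obtain ⟨b, -, hb⟩ := Finset.exists_ne_zero_of_sum_ne_zero ha
  exact (hlt a b (left_ne_zero_of_mul hb)).trans_le (hf b (right_ne_zero_of_mul hb))

/-- The images of the basis elements of `F` under a comparison map to the Taylor complex. -/
def taylorLift (F : MultigradedSeq k n) (m : Fin r → (Fin n →₀ ℕ)) :
    ∀ i, F.ι i → (Finset (Fin r) → k)
  | 0 => fun _ => Pi.single ∅ 1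
  | i + 1 => fun e => apexCone k m (F.deg (i + 1) e)
      (Fintype.linearCombination k (taylorLift F m i) fun a => F.coef i a e)

variable {F : MultigradedSeq k n}

lemma grounded_taylorLift (hS : F.StartsWith m) : Grounded F.deg (taylorLift F m) := by
  obtain ⟨e₀, e₁, h0, -⟩ := hS
  refine ⟨e₀ (), fun e => ?_, h0, rfl⟩
  obtain ⟨⟨⟩, rfl⟩ := e₀.surjective e
  rfl

lemma coef_zero_eq_one (hS : F.StartsWith m) (a : F.ι 0) (b : F.ι 1) : F.coef 0 a b = 1 := by
  obtain ⟨e₀, e₁, h0, h1⟩ := hS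
  obtain ⟨⟨⟩, rfl⟩ := e₀.surjective a
  obtain ⟨j, rfl⟩ := e₁.surjective b
  rw [MultigradedSeq.coef, (h1 j).2, (h1 j).1, h0, tsub_zero, coeff_monomial, if_pos rfl]

lemma taylorLift_mem (hlt : ∀ i a b, F.coef i a b ≠ 0 → F.deg i a < F.deg (i + 1) b)
    (i : ℕ) (e : F.ι i) :
    taylorLift F m i e ∈ chains k (belowComplex m (LowerSet.Iic (F.deg i e))) i := by
  induction i with
  | zero => exact single_empty_mem_chains (LowerSet.mem_Iic_iff.2 zero_le)
  | succ i ih =>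
    refine apexCone_mem (realize_mem_chains (fun a _ => ih a) fun a ha => ?_)
    exact (hlt i a e ha).le

/-- Coning inverts the boundary on cycles, and the previous combination is a cycle because `F` is a
complex. In the first step the cone needs an apex, supplied by the generator whose degree `e` has.
-/
lemma boundary_taylorLift (hlt : ∀ i a b, F.coef i a b ≠ 0 → F.deg i a < F.deg (i + 1) b)
    (hcomp : ∀ i g, F.dehom i (F.dehom (i + 1) g) = 0) (hS : F.StartsWith m) (i : ℕ)
    (e : F.ι (i + 1)) :
    boundary k (taylorLift F m (i + 1) e) =
      realize (taylorLift F m) i fun a => F.coef i a e := by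
  have hmem : realize (taylorLift F m) i (fun a => F.coef i a e) ∈
      chains k (belowComplex m (LowerSet.Iic (F.deg (i + 1) e))) i :=
    realize_mem_chains (fun a _ => taylorLift_mem hlt i a) fun a ha => (hlt i a e ha).le
  induction i with
  | zero =>
    refine boundary_apexCone ?_ ⟨hmem, LinearMap.mem_ker.2 ?_⟩
    · obtain ⟨e₀, e₁, h0, h1⟩ := hS
      obtain ⟨j, rfl⟩ := e₁.surjective e
      exact ⟨j, by simp [label, (h1 j).1]⟩
    · obtain ⟨e₀, -, -, h⟩ := (grounded_taylorLift hS).realize_zero fun a => F.coef 0 a e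
      rw [h, map_smul, boundary_single_empty, smul_zero]
  | succ i ih =>
    refine boundary_apexCone_succ ⟨hmem, LinearMap.mem_ker.2 ?_⟩
    rw [boundary_realize_dehom (F := F) fun e => ih e (realize_mem_chains
      (fun a _ => taylorLift_mem hlt i a) fun a ha => (hlt i a e ha).le)]
    have h1 : (fun a => F.coef (i + 1) a e) = F.dehom (i + 1) (Pi.single e 1) := by
      ext a
      rw [F.dehom_apply, Finset.sum_eq_single e]
      · simp
      · intro b _ hb
        rw [Pi.single_eq_of_ne hb, mul_zero]
      · simp
    rw [h1, hcomp, map_zero]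

/-- By induction on `b`, relative acyclicity holds strictly below `b` and translates simplicial
statements there into statements about `F`. Exactness of the strand at `b` then gives spanning, and
together with minimality it gives independence. -/
lemma admissibleAt_taylorLift (hm : ∀ j, m j ≠ 0) (hS : F.StartsWith m)
    (hlt : ∀ i a b, F.coef i a b ≠ 0 → F.deg i a < F.deg (i + 1) b)
    (hcomp : ∀ i g, F.dehom i (F.dehom (i + 1) g) = 0)
    (hexact : ∀ i, ∀ β : Fin n →₀ ℕ,
      ∀ f ∈ supportedOn k (F.deg (i + 1)) (LowerSet.Iic β : LowerSet (Fin n →₀ ℕ)),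
        F.dehom i f = 0 →
          ∃ g ∈ supportedOn k (F.deg (i + 2)) (LowerSet.Iic β : LowerSet (Fin n →₀ ℕ)),
            F.dehom (i + 1) g = f) (b : Fin n →₀ ℕ) :
    AdmissibleAt m F.deg (taylorLift F m) b := by
  induction b using WellFoundedLT.induction with
  | _ b ih =>
  have hG := grounded_taylorLift hS
  have hbd := boundary_taylorLift hlt hcomp hS
  have hD : ∀ x ∈ LowerSet.Iio b, AdmissibleAt m F.deg (taylorLift F m) x := fun x hx => ih x hx
  constructor
  · rintro i e rfl
    exact taylorLift_mem hlt i e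
  · rintro i e rfl
    exact ⟨_, fun a ha => hlt i a e ha, (hbd i e).symm⟩
  · rintro i f hf ⟨s, hs, hsf⟩
    have hf' := supportedOn_mono (singleton_subset_Iic b) hf
    rw [boundary_realize_dehom (hbd i)] at hsf
    obtain ⟨μ, hμ, s', hs', rfl⟩ := exists_realize_add_boundary hm hG _ hD hs
      (dehom_mem (hlt i) hf') hsf
    have hμ' := supportedOn_mono (Iio_le_Iic b) hμ
    rw [map_add, boundary_boundary, add_zero, boundary_realize_dehom (hbd i)] at hsf
    have h1 : F.dehom i (f - μ) = 0 := by
      refine realize_injective hG hD (dehom_mem (hlt i) (Submodule.sub_mem _ hf' hμ')) ?_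
      rw [map_sub, map_sub, hsf, sub_self]
    obtain ⟨y, hy, hyf⟩ := hexact i b _ (Submodule.sub_mem _ hf' hμ') h1
    -- Up to a vector `μ` supported below `b`, `f` is in the image of the differential of `F`. By
    -- minimality images of the strand are supported strictly below `b`, whereas `f` is supported in
    -- degree `b`.
    have h2 : f ∈ supportedOn k (F.deg (i + 1)) (LowerSet.Iio b : LowerSet (Fin n →₀ ℕ)) := by
      rw [← sub_add_cancel f μ, ← hyf]
      exact Submodule.add_mem _ (dehom_mem (hlt (i + 1)) hy) hμ
    ext e
    by_contra he
    exact (LowerSet.mem_Iio_iff.1 (h2 e he)).ne (hf e he)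
  · intro hb i z hz
    have key : ∃ g ∈ supportedOn k (F.deg (i + 1)) (LowerSet.Iic b : LowerSet (Fin n →₀ ℕ)),
        ∃ t ∈ chains k (belowComplex m (LowerSet.Iio b)) (i + 1),
          z = realize (taylorLift F m) i (F.dehom i g) + boundary k t := by
      cases i with
      | zero =>
        -- The exactness hypothesis starts at `F₁`, so dimension -1 is treated directly: the empty
        -- face is the boundary of the chain of any generator dividing `b`.
        obtain ⟨f, hf, rfl⟩ := hG.exists_realize_eq hz.1
        by_cases hf0 : f = 0
        · exact ⟨0, Submodule.zero_mem _, 0, Submodule.zero_mem _, by simp [hf0]⟩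
        obtain ⟨e, he⟩ := Function.ne_iff.1 hf0
        have hb0 : 0 < b := by
          have := hf e he
          rwa [hG.deg_zero] at this
        obtain ⟨j, hj⟩ := label_nonempty (b := ⟨b, hb⟩) hb0.ne'
        obtain ⟨e₀, e₁, h0, h1⟩ := id hS
        refine ⟨Pi.single (e₁ j) (f e), fun a ha => ?_, 0, Submodule.zero_mem _, ?_⟩
        · obtain rfl : a = e₁ j := by
            by_contra hne
            exact ha (Pi.single_eq_of_ne hne _)
          rw [(h1 j).1]
          exact (Finset.mem_filter.1 hj).2
        · rw [map_zero, add_zero]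
          congr 1
          ext a
          obtain ⟨e', he', -⟩ := hG
          rw [F.dehom_apply, Finset.sum_eq_single (e₁ j), coef_zero_eq_one hS, Pi.single_eq_same,
            one_mul, he' a, he' e]
          · intro c _ hc
            rw [Pi.single_eq_of_ne hc, mul_zero]
          · simp
      | succ i =>
        obtain ⟨f, hf, t, ht, hzt⟩ := exists_realize_add_boundary hm hG _ hD hz.1
          (Submodule.zero_mem _) (by rw [LinearMap.mem_ker.1 hz.2, map_zero])
        have h1 : F.dehom i f = 0 := by
          refine realize_injective hG hD (supportedOn_mono ?_ (dehom_mem (hlt i)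
            (supportedOn_mono (Iio_le_Iic b) hf))) ?_
          · exact subset_rfl
          · have := LinearMap.mem_ker.1 hz.2
            rwa [hzt, map_add, boundary_boundary, add_zero, boundary_realize_dehom (hbd i)] at this
        obtain ⟨g, hg, hgf⟩ := hexact i b f (supportedOn_mono (Iio_le_Iic b) hf) h1
        exact ⟨g, hg, t, ht, by rw [hgf, hzt]⟩
    obtain ⟨g, hg, t, ht, rfl⟩ := key
    refine ⟨_, degreePart_mem _ b g, realize (taylorLift F m) (i + 1)
      (g - degreePart (F.deg (i + 1)) b g) + t, Submodule.add_mem _ ?_ ht, ?_⟩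
    · exact AdmissibleAt.realize_mem hD
        (sub_degreePart_mem hg fun e he hne => lt_of_le_of_ne he hne)
    · rw [← boundary_realize_dehom (hbd i), map_add, map_sub, map_sub]
      abel

/-- The choices given by the boundaries of an admissible family of chains. -/
def choicesOf {w : ∀ i, F.ι i → (Finset (Fin r) → k)} (hA : ∀ b, AdmissibleAt m F.deg w b)
    (hw : ∀ e, boundary k (w 1 e) = Pi.single ∅ 1)
    (σ : ∀ (b : LcmLattice m) (c : ℕ), Fin (Module.finrank k (RedHomology k (delta m b) c)) ≃
      {a : F.ι (c + 1) // F.deg (c + 1) a = b.1}) : Choices k m where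
  basis b c := (classBasis hA b c).reindex (σ b c).symm
  basis_zero b a := ⟨⟨_, boundary_mem_cycles_delta hA b 0 (σ b 0 a)⟩, hw _, by
    rw [Module.Basis.reindex_apply, classBasis_apply]
    rfl⟩
  lift b c j := homologyClass k _ _ ⟨boundary k (w (c + 2) (σ b (c + 1) j)), by
    obtain ⟨f, hf, hfe⟩ := (hA _).bdry (c + 1) _ (σ b (c + 1) j).2
    exact ⟨hfe ▸ realize_mem_deltaSub hA hf, boundary_boundary _⟩⟩
  lift_spec b c j := by
    rw [inclusionMap_homologyClass, Module.Basis.reindex_apply, classBasis_apply]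
    rfl

theorem exists_choices_of_resolution (hm : ∀ j, m j ≠ 0)
    (hF : F.IsMinimalFreeResolution (monomialIdeal k m)) (hS : F.StartsWith m) :
    ∃ C : Choices k m, F.approx.Equal C.G := by
  have hlt : ∀ i a b, F.coef i a b ≠ 0 → F.deg i a < F.deg (i + 1) b :=
    fun i a b => MultigradedSeq.deg_lt_of_coef (hF.minimal i a b)
  have hcomp := fun i => ((MultigradedSeq.exact_iff_dehom i).1 (hF.exact i)).1
  have hA := admissibleAt_taylorLift hm hS hlt hcomp
    fun i => ((MultigradedSeq.exact_iff_dehom i).1 (hF.exact i)).2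
  have hG := grounded_taylorLift hS
  have hbd := boundary_taylorLift hlt hcomp hS
  have hw : ∀ e, boundary k (taylorLift F m 1 e) = Pi.single ∅ 1 := by
    intro e
    obtain ⟨e₀, -, -, h⟩ := hG.realize_zero fun a => F.coef 0 a e
    rw [hbd, h, coef_zero_eq_one hS, one_smul]
  let σ : ∀ (b : LcmLattice m) (c : ℕ), Fin (Module.finrank k (RedHomology k (delta m b) c)) ≃
      {a : F.ι (c + 1) // F.deg (c + 1) a = b.1} := fun b c =>
    (finCongr (Module.finrank_eq_card_basis (classBasis hA b c))).trans (Fintype.equivFin _).symm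
  refine ⟨choicesOf hA hw σ, approx_equal_G hG hA hbd hlt (coef_zero_eq_one hS) _ σ
    (fun b c j => ?_) (fun b c j => ⟨_, rfl, rfl⟩)⟩
  change (classBasis hA b c).reindex (σ b c).symm j = _
  rw [Module.Basis.reindex_apply, classBasis_apply]
  rfl

end FromResolution

/-! ### An admissible family makes its sequence a minimal resolution -/

section ToResolution

open MvPolynomial

variable {k : Type u} [Field k] {n r : ℕ} {m : Fin r → (Fin n →₀ ℕ)}
  {F : MultigradedSeq k n} {w : ∀ i, F.ι i → (Finset (Fin r) → k)}

/-- There are no faces with more than `r` vertices, so the chain would be zero, contradicting linear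
independence. -/
lemma isEmpty_of_lt (hG : Grounded F.deg w) (hA : ∀ b, AdmissibleAt m F.deg w b) {i : ℕ}
    (hi : r < i) : IsEmpty (F.ι i) := by
  refine ⟨fun e => ?_⟩
  have h0 : w i e = 0 := by
    ext A
    by_contra h
    have h1 := ((hA _).carried i e rfl A h).2
    have h2 := Finset.card_le_univ A
    rw [Fintype.card_fin] at h2
    omega
  have h1 := realize_injective (D := ⊤) hG (fun b _ => hA b) (i := i) (f := Pi.single e 1)
    (fun _ _ => trivial) (by rw [Fintype.linearCombination_apply_single, h0, smul_zero])
  simpa using congrFun h1 e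

/-- A cycle of the strand at `β` becomes a simplicial cycle in the simplex below `β` and bounds a
cone. Relative acyclicity replaces the cone, up to a boundary, by a combination of the given chains,
and injectivity carries the resulting equation back to `F`. -/
lemma exact_of_frame (hm : ∀ j, m j ≠ 0) (hG : Grounded F.deg w)
    (hA : ∀ b, AdmissibleAt m F.deg w b)
    (hbd : ∀ i e, boundary k (w (i + 1) e) = realize w i fun a => F.coef i a e) (i : ℕ) :
    Function.Exact (F.map (i + 1)) (F.map i) := by
  have hinj : ∀ i (f : F.ι i → k), realize w i f = 0 → f = 0 := fun i f hf =>
    realize_injective (D := ⊤) hG (fun b _ => hA b) (fun _ _ => trivial) hf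
  refine (MultigradedSeq.exact_iff_dehom i).2 ⟨fun g => ?_, fun β f hf hf0 => ?_⟩
  · apply hinj
    rw [← boundary_realize_dehom (hbd _), ← boundary_realize_dehom (hbd _), boundary_boundary]
  · have hz : realize w (i + 1) f ∈ cycles k (belowComplex m (LowerSet.Iic β)) (i + 1) := by
      refine ⟨AdmissibleAt.realize_mem (fun b _ => hA b) hf, LinearMap.mem_ker.2 ?_⟩
      rw [boundary_realize_dehom (hbd _), hf0, map_zero]
    obtain ⟨g, hg, s, -, hgs⟩ := exists_realize_add_boundary hm hG _ (fun b _ => hA b)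
      (apexCone_mem hz.1) hf (boundary_apexCone_succ hz)
    refine ⟨g, hg, sub_eq_zero.1 (hinj _ _ ?_)⟩
    rw [map_sub, ← boundary_realize_dehom (hbd _), ← boundary_apexCone_succ hz, hgs, map_add,
      boundary_boundary, add_zero, sub_self]

/-- No generator strictly divides `m j`, so the complex at `m j` is `{∅}` and the empty face is not
a boundary. -/
lemma exists_deg_eq_generator (hm : ∀ j, m j ≠ 0) (hmin : ∀ i j, m i ≤ m j → i = j)
    (hA : ∀ b, AdmissibleAt m F.deg w b) (j : Fin r) : ∃ e, F.deg 1 e = m j := by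
  refine (nontrivial_iff_exists_deg hA ⟨m j, {j}, Finset.sup_singleton⟩ 0).1 ?_
  have h0 : (Pi.single ∅ 1 : Finset (Fin r) → k) ∈
      cycles k (delta m ⟨m j, {j}, Finset.sup_singleton⟩) 0 := by
    rw [delta_eq_belowComplex]
    exact ⟨single_empty_mem_chains (LowerSet.mem_Iio_iff.2 (pos_iff_ne_zero.2 (hm j))),
      LinearMap.mem_ker.2 boundary_single_empty⟩
  refine ⟨homologyClass k _ _ ⟨_, h0⟩, 0, fun h => ?_⟩
  rw [homologyClass_eq_zero] at h
  obtain ⟨g, hg, hg0⟩ := h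
  have : g = 0 := by
    ext A
    by_contra hA'
    obtain ⟨h1, h2⟩ := hg A hA'
    obtain ⟨i, rfl⟩ := Finset.card_eq_one.1 h2
    rw [delta_eq_belowComplex, mem_belowComplex, Finset.sup_singleton] at h1
    have h3 : m i < m j := h1
    exact h3.ne (by rw [hmin i j h3.le])
  rw [this, map_zero] at hg0
  simpa using congrFun hg0 ∅

lemma map_zero_apply (hG : Grounded F.deg w) (hone : ∀ a b, F.coef 0 a b = 1)
    (g : F.ι 1 → MvPolynomial (Fin n) k) (a : F.ι 0) :
    F.map 0 g a = ∑ b, monomial (F.deg 1 b) 1 * g b := by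
  rw [F.map_apply]
  refine Finset.sum_congr rfl fun b _ => ?_
  rw [F.d_eq, hone, hG.deg_zero, tsub_zero]

lemma range_map_zero (hm : ∀ j, m j ≠ 0) (hmin : ∀ i j, m i ≤ m j → i = j)
    (hG : Grounded F.deg w) (hA : ∀ b, AdmissibleAt m F.deg w b)
    (hone : ∀ a b, F.coef 0 a b = 1) {e₀ : F.ι 0} (he₀ : ∀ e, e = e₀)
    (f : F.ι 0 → MvPolynomial (Fin n) k) :
    f ∈ LinearMap.range (F.map 0) ↔ f e₀ ∈ monomialIdeal k m := by
  constructor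
  · rintro ⟨g, rfl⟩
    rw [map_zero_apply hG hone]
    refine Ideal.sum_mem _ fun b _ => Ideal.mul_mem_right _ _ ?_
    obtain ⟨j, hj⟩ := label_nonempty (b := ⟨_, (hA _).mem_lcm⟩) (deg_ne_zero hA b)
    have hj' : m j ≤ F.deg 1 b := (Finset.mem_filter.1 hj).2
    have h1 : (monomial (F.deg 1 b) 1 : MvPolynomial (Fin n) k) =
        monomial (F.deg 1 b - m j) 1 * monomial (m j) 1 := by
      rw [monomial_mul, tsub_add_cancel_of_le hj', one_mul]
    rw [h1]
    exact Ideal.mul_mem_left _ _ (Ideal.subset_span ⟨j, rfl⟩)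
  · intro hf
    have h1 : monomialIdeal k m ≤
        (LinearMap.range (F.map 0)).comap
          (LinearMap.single (MvPolynomial (Fin n) k) (fun _ => MvPolynomial (Fin n) k) e₀) := by
      refine Ideal.span_le.2 ?_
      rintro _ ⟨j, rfl⟩
      obtain ⟨b, hb⟩ := exists_deg_eq_generator hm hmin hA j
      refine ⟨Pi.single b 1, ?_⟩
      ext1 a
      rw [map_zero_apply hG hone, he₀ a, Finset.sum_eq_single b]
      · simp [hb]
      · intro c _ hc
        rw [Pi.single_eq_of_ne hc, mul_zero]
      · simp
    have h2 := h1 hf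
    have h3 : LinearMap.single (MvPolynomial (Fin n) k) (fun _ => MvPolynomial (Fin n) k) e₀
        (f e₀) = f := by
      ext1 a
      rw [he₀ a]
      simp
    rw [Submodule.mem_comap, h3] at h2
    exact h2

theorem isMinimalFreeResolution_of_frame (hm : ∀ j, m j ≠ 0) (hmin : ∀ i j, m i ≤ m j → i = j)
    (hG : Grounded F.deg w) (hA : ∀ b, AdmissibleAt m F.deg w b)
    (hbd : ∀ i e, boundary k (w (i + 1) e) = realize w i fun a => F.coef i a e)
    (hlt : ∀ i a b, F.coef i a b ≠ 0 → F.deg i a < F.deg (i + 1) b)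
    (hone : ∀ a b, F.coef 0 a b = 1) : F.IsMinimalFreeResolution (monomialIdeal k m) where
  bounded := ⟨r, fun i hi => isEmpty_of_lt hG hA hi⟩
  exact := exact_of_frame hm hG hA hbd
  augmentation := by
    obtain ⟨e₀, he₀, h0, -⟩ := id hG
    refine ⟨(Submodule.mkQ (monomialIdeal k m)).comp (LinearMap.proj e₀), ?_, ?_, ?_⟩
    · intro x
      obtain ⟨p, rfl⟩ := Submodule.mkQ_surjective _ x
      exact ⟨fun _ => p, rfl⟩
    · intro f
      exact (Submodule.Quotient.mk_eq_zero _).trans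
        (range_map_zero hm hmin hG hA hone he₀ f).symm
    · intro a
      refine ⟨1, ?_⟩
      rw [he₀ a, h0]
      change Submodule.mkQ (monomialIdeal k m) ((Pi.single e₀ 1 : F.ι 0 → _) e₀) = _
      rw [Pi.single_eq_same]
      rfl
  minimal i a b := by
    rw [F.d_eq, MultigradedSeq.monomial_mem_span_X]
    by_cases h : F.coef i a b = 0
    · exact Or.inl h
    · exact Or.inr fun h' => (hlt i a b h).not_ge (tsub_eq_zero_iff_le.1 h')

end ToResolution

/-! ### From choices to a minimal resolution -/

section FrameOfChoices

open MvPolynomial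

variable {k : Type u} [Field k] {n r : ℕ} {m : Fin r → (Fin n →₀ ℕ)}

instance (i : ℕ) : Fintype (GIndex k m i) :=
  match i with
  | 0 => inferInstanceAs (Fintype Unit)
  | c + 1 => Fintype.ofFinite (Σ b : {b : LcmLattice m // b.1 ≠ 0},
      Fin (Module.finrank k (RedHomology k (delta m b.1) c)))

/-- A family of chains indexed by the basis elements of `𝓖(L_M)` in positive homological degree. -/
abbrev ChainFamily (k : Type u) [Field k] (m : Fin r → (Fin n →₀ ℕ)) : Type u :=
  ∀ (b : {b : LcmLattice m // b.1 ≠ 0}) (c : ℕ),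
    Fin (Module.finrank k (RedHomology k (delta m b.1) c)) → (Finset (Fin r) → k)

/-- The extension of a family of chains by the empty face. -/
def frameOf (v : ChainFamily k m) : ∀ i, GIndex k m i → (Finset (Fin r) → k)
  | 0 => fun _ => Pi.single ∅ 1
  | c + 1 => fun x => v x.1 c x.2

lemma grounded_frameOf (v : ChainFamily k m) : Grounded (GDeg k m) (frameOf v) :=
  ⟨(), fun _ => rfl, rfl, rfl⟩

/-- The boundary of `y` represents the chosen preimage of the `j`-th basis element. -/
def Choices.Lifts (C : Choices k m) (b : LcmLattice m) : ∀ c,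
    Fin (Module.finrank k (RedHomology k (delta m b) c)) → (Finset (Fin r) → k) → Prop
  | 0, _, y => boundary k y = Pi.single ∅ 1
  | c + 1, j, y => ∃ z : cycles k (deltaSub m k c b) (c + 1),
      z.1 = boundary k y ∧ C.lift b c j = homologyClass k _ _ z

/-- The chains of degree `b` in the family `v` realize the choices `C`. -/
def Choices.GoodAt (C : Choices k m) (v : ChainFamily k m)
    (b : {b : LcmLattice m // b.1 ≠ 0}) : Prop :=
  ∀ c j, v b c j ∈ chains k (belowComplex m (LowerSet.Iic b.1.1)) (c + 1) ∧
    boundary k (v b c j) ∈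
      (supportedOn k (GDeg k m c) (Set.Iio b.1.1)).map (realize (frameOf v) c) ∧
    C.Lifts b.1 c j (v b c j)

lemma Choices.Lifts.basis_eq {C : Choices k m} {b : LcmLattice m} {c : ℕ}
    {j : Fin (Module.finrank k (RedHomology k (delta m b) c))} {y : Finset (Fin r) → k}
    (h : C.Lifts b c j y) :
    ∃ z : cycles k (delta m b) c, z.1 = boundary k y ∧
      C.basis b c j = homologyClass k (delta m b) c z := by
  cases c with
  | zero =>
    obtain ⟨z, hz, h1⟩ := C.basis_zero b j
    exact ⟨z, hz.trans (Eq.symm h), h1⟩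
  | succ c =>
    obtain ⟨z, hz, h1⟩ := h
    refine ⟨⟨z.1, cycles_mono (deltaSub_le_delta k c b) _ z.2⟩, hz, ?_⟩
    rw [← C.lift_spec, h1, inclusionMap_homologyClass]

lemma realize_frameOf (v : ChainFamily k m) (b : {b : LcmLattice m // b.1 ≠ 0}) (c : ℕ)
    {f : GIndex k m (c + 1) → k} (hf : f ∈ supportedOn k (GDeg k m (c + 1)) {b.1.1}) :
    realize (frameOf v) (c + 1) f = ∑ j, f ⟨b, j⟩ • v b c j := by
  rw [Fintype.linearCombination_apply]
  let e : Fin (Module.finrank k (RedHomology k (delta m b.1) c)) → GIndex k m (c + 1) :=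
    fun j => ⟨b, j⟩
  refine (Fintype.sum_of_injective e ?_ _ _ ?_ ?_).symm
  · intro j j' h
    exact eq_of_heq (Sigma.mk.inj h).2
  · rintro ⟨b', j⟩ h
    by_cases h0 : f ⟨b', j⟩ = 0
    · rw [h0, zero_smul]
    · obtain rfl : b' = b := Subtype.ext (Subtype.ext (hf _ h0))
      exact absurd ⟨j, rfl⟩ h
  · intro j
    rfl

lemma Choices.GoodAt.homologyClass_boundary {C : Choices k m} {v : ChainFamily k m}
    {b : {b : LcmLattice m // b.1 ≠ 0}} (h : C.GoodAt v b) (c : ℕ)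
    (g : Fin (Module.finrank k (RedHomology k (delta m b.1) c)) → k) :
    ∃ z : cycles k (delta m b.1) c, z.1 = boundary k (∑ j, g j • v b c j) ∧
      homologyClass k (delta m b.1) c z = ∑ j, g j • C.basis b.1 c j := by
  choose z hz hC using fun j => (h c j).2.2.basis_eq
  refine ⟨∑ j, g j • z j, ?_, ?_⟩
  · simp [hz]
  · simp [hC]

lemma admissibleAt_frameOf {C : Choices k m} {v : ChainFamily k m} (β : Fin n →₀ ℕ)
    (h : ∀ b, b.1.1 = β → C.GoodAt v b) : AdmissibleAt m (GDeg k m) (frameOf v) β where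
  carried i e he := by
    subst he
    cases i with
    | zero => exact single_empty_mem_chains (LowerSet.mem_Iic_iff.2 zero_le)
    | succ c => exact (h e.1 rfl c e.2).1
  bdry i e he := by
    subst he
    exact (h e.1 rfl i e.2).2.1
  indep i f hf hs := by
    ext ⟨b, j⟩
    by_contra h0
    obtain rfl : b.1.1 = β := hf _ h0
    rw [realize_frameOf v b i hf, ← delta_eq_belowComplex] at hs
    obtain ⟨z, hz, hzC⟩ := (h b rfl).homologyClass_boundary i fun j => f ⟨b, j⟩
    rw [← hz, ← homologyClass_eq_zero, hzC] at hs
    exact h0 (Fintype.linearIndependent_iff.1 (C.basis b.1 i).linearIndependent _ hs j)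
  spans hβ i z hz := by
    -- Degree `1` carries no index in positive homological degree; the complex there is void, so
    -- nothing has to be spanned.
    by_cases hβ0 : β = 0
    · subst hβ0
      refine ⟨0, Submodule.zero_mem _, ?_⟩
      rw [chains_Iio_zero hz.1, map_zero, map_zero, sub_zero]
      exact Submodule.zero_mem _
    obtain ⟨b, rfl⟩ : ∃ b : {b : LcmLattice m // b.1 ≠ 0}, b.1.1 = β := ⟨⟨⟨β, hβ⟩, hβ0⟩, rfl⟩
    rw [← delta_eq_belowComplex] at hz ⊢
    set g := (C.basis b.1 i).repr (homologyClass k _ _ ⟨z, hz⟩) with hg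
    let f : GIndex k m (i + 1) → k := fun x => if hx : x.1 = b then g (hx ▸ x.2) else 0
    have hf : f ∈ supportedOn k (GDeg k m (i + 1)) {b.1.1} := by
      rintro ⟨b', j⟩ hb'
      by_contra hne
      refine hb' (dif_neg fun hx => hne ?_)
      change b' = b at hx
      subst hx
      rfl
    refine ⟨f, hf, ?_⟩
    have hfg : ∀ j, f ⟨b, j⟩ = g j := fun j => dif_pos rfl
    rw [realize_frameOf v b i hf]
    obtain ⟨z', hz', hzC⟩ := (h b rfl).homologyClass_boundary i g
    simp only [hfg]
    rw [hg, (C.basis b.1 i).sum_repr, eq_comm, homologyClass_eq_iff, hz'] at hzC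
    exact hzC

/-- The conditions on chains of degree `b` refer only to chains of smaller degree, so altering the
family elsewhere does no harm in the recursion. -/
lemma realize_frameOf_congr {v v' : ChainFamily k m} {β : Fin n →₀ ℕ}
    (h : ∀ b, b.1.1 < β → v b = v' b) {i : ℕ} {f : GIndex k m i → k}
    (hf : f ∈ supportedOn k (GDeg k m i) (Set.Iio β)) :
    realize (frameOf v) i f = realize (frameOf v') i f := by
  rw [Fintype.linearCombination_apply, Fintype.linearCombination_apply]
  refine Finset.sum_congr rfl fun e _ => ?_
  cases i with
  | zero => rfl
  | succ c =>
    by_cases h0 : f e = 0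
    · rw [h0, zero_smul, zero_smul]
    · change f e • v e.1 c e.2 = f e • v' e.1 c e.2
      rw [h e.1 (hf e h0)]

lemma labelComplex_eq_belowComplex (T : Set (LcmLattice m)) :
    labelComplex m T = belowComplex m (lowerClosure (Subtype.val '' T)) := by
  ext A
  rw [SetLike.mem_coe, SetLike.mem_coe, mem_labelComplex, mem_belowComplex, mem_lowerClosure]
  simp only [Set.exists_mem_image, subset_label]

/-- A cycle representing the chosen preimage is homologous inside `Δ_b^{(c)}`, by relative
acyclicity there, to a combination of chains already constructed. That combination is a cycle in the
simplex below `b`, and its cone is the required chain. -/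
lemma exists_chain (hm : ∀ j, m j ≠ 0) (C : Choices k m) (v : ChainFamily k m)
    (b : {b : LcmLattice m // b.1 ≠ 0}) (hv : ∀ b', b'.1.1 < b.1.1 → C.GoodAt v b') (c : ℕ)
    (j : Fin (Module.finrank k (RedHomology k (delta m b.1) c))) :
    ∃ y ∈ chains k (belowComplex m (LowerSet.Iic b.1.1)) (c + 1),
      boundary k y ∈ (supportedOn k (GDeg k m c) (Set.Iio b.1.1)).map (realize (frameOf v) c) ∧
      C.Lifts b.1 c j y := by
  have hpos : 0 < b.1.1 := pos_iff_ne_zero.2 b.2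
  have hG := grounded_frameOf v
  cases c with
  | zero =>
    have h0 : (Pi.single ∅ 1 : Finset (Fin r) → k) ∈
        cycles k (belowComplex m (LowerSet.Iic b.1.1)) 0 :=
      ⟨single_empty_mem_chains (LowerSet.mem_Iic_iff.2 zero_le),
        LinearMap.mem_ker.2 boundary_single_empty⟩
    have h1 := boundary_apexCone (label_nonempty b.2) h0
    refine ⟨apexCone k m b.1.1 (Pi.single ∅ 1), apexCone_mem h0.1, ?_, h1⟩
    rw [h1]
    obtain ⟨f, hf, h2⟩ := hG.exists_realize_eq (D := LowerSet.Iio b.1.1)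
      (single_empty_mem_chains (m := m) (k := k) (LowerSet.mem_Iio_iff.2 hpos))
    exact ⟨f, hf, h2.symm⟩
  | succ c =>
    obtain ⟨⟨z, hz⟩, hzC⟩ := homologyClass_surjective _ _ (C.lift b.1 c j)
    have hz1 := hz.1
    rw [deltaSub, labelComplex_eq_belowComplex] at hz1
    set D : LowerSet (Fin n →₀ ℕ) := lowerClosure (Subtype.val '' topBelow m k c b.1) with hD
    have hDb : D ≤ LowerSet.Iio b.1.1 := by
      refine lowerClosure_le.2 ?_
      rintro _ ⟨γ, hγ, rfl⟩
      exact hγ.1.2.2.1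
    obtain ⟨g, hg, s, hs, hgs⟩ := exists_realize_add_boundary hm hG D
      (fun β hβ => admissibleAt_frameOf β fun b' hb' => hv b' (hb' ▸ hDb hβ)) hz1
      (Submodule.zero_mem _) (by rw [LinearMap.mem_ker.1 hz.2, map_zero])
    have hg1 : realize (frameOf v) (c + 1) g ∈ chains k (belowComplex m D) (c + 1) :=
      AdmissibleAt.realize_mem
        (fun β hβ => admissibleAt_frameOf β fun b' hb' => hv b' (hb' ▸ hDb hβ)) hg
    have hg0 : boundary k (realize (frameOf v) (c + 1) g) = 0 := by
      have := LinearMap.mem_ker.1 hz.2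
      rwa [hgs, map_add, boundary_boundary, add_zero] at this
    have hg2 : realize (frameOf v) (c + 1) g ∈
        cycles k (belowComplex m (LowerSet.Iic b.1.1)) (c + 1) :=
      ⟨chains_mono (belowComplex_mono (hDb.trans (Iio_le_Iic _))) _ hg1, hg0⟩
    have hy := boundary_apexCone_succ hg2
    have hg3 : realize (frameOf v) (c + 1) g ∈ cycles k (deltaSub m k c b.1) (c + 1) := by
      rw [deltaSub, labelComplex_eq_belowComplex]
      exact ⟨hg1, hg0⟩
    refine ⟨_, apexCone_mem hg2.1, ⟨g, supportedOn_mono hDb hg, hy.symm⟩, ⟨_, hg3⟩, hy.symm, ?_⟩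
    rw [← hzC, homologyClass_eq_iff]
    refine ⟨s, ?_, ?_⟩
    · rw [deltaSub, labelComplex_eq_belowComplex]
      exact hs
    · exact (sub_eq_iff_eq_add'.2 hgs).symm

lemma exists_chainFamily (hm : ∀ j, m j ≠ 0) (C : Choices k m)
    (T : Finset {b : LcmLattice m // b.1 ≠ 0})
    (hT : IsLowerSet (T : Set {b : LcmLattice m // b.1 ≠ 0})) :
    ∃ v : ChainFamily k m, ∀ b ∈ T, C.GoodAt v b := by
  induction T using Finset.strongInduction with
  | H T ih =>
    rcases T.eq_empty_or_nonempty with rfl | hne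
    · exact ⟨fun _ _ _ => 0, fun b hb => absurd hb (Finset.notMem_empty b)⟩
    -- With `b` maximal in `T`, no element of `T` lies above it, so inserting chains at `b` leaves
    -- the conditions at the other elements intact.
    obtain ⟨b, hb⟩ := T.exists_maximal hne
    obtain ⟨v, hv⟩ := ih (T.erase b) (Finset.erase_ssubset hb.1) (by
      intro x y hyx hx
      rw [Finset.mem_coe, Finset.mem_erase] at hx ⊢
      refine ⟨?_, hT hyx hx.2⟩
      rintro rfl
      exact hx.1 (le_antisymm (hb.2 hx.2 hyx) hyx))
    have hlt : ∀ b', b'.1.1 < b.1.1 → C.GoodAt v b' := by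
      intro b' hb'
      refine hv b' (Finset.mem_erase.2 ⟨?_, hT (show b' ≤ b from le_of_lt hb') hb.1⟩)
      rintro rfl
      exact lt_irrefl _ hb'
    choose y hy1 hy2 hy3 using exists_chain hm C v b hlt
    have hcongr : ∀ b' ∈ T, ∀ (i : ℕ) (f : GIndex k m i → k),
        f ∈ supportedOn k (GDeg k m i) (Set.Iio b'.1.1) →
        realize (frameOf (Function.update v b y)) i f = realize (frameOf v) i f := by
      intro b' hb' i f hf
      refine realize_frameOf_congr (fun b'' hb'' => Function.update_of_ne ?_ _ _) hf
      rintro rfl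
      exact (show b'' < b' from hb'').not_ge (hb.2 hb' (show b'' ≤ b' from le_of_lt hb''))
    refine ⟨Function.update v b y, fun b' hb' c j => ?_⟩
    by_cases hbb : b' = b
    · subst hbb
      rw [Function.update_self]
      obtain ⟨f, hf, hfy⟩ := hy2 c j
      exact ⟨hy1 c j, ⟨f, hf, (hcongr _ hb' _ _ hf).trans hfy⟩, hy3 c j⟩
    · rw [Function.update_of_ne hbb]
      obtain ⟨h1, ⟨f, hf, hfy⟩, h3⟩ := hv b' (Finset.mem_erase.2 ⟨hbb, hb'⟩) c j
      exact ⟨h1, ⟨f, hf, (hcongr _ hb' _ _ hf).trans hfy⟩, h3⟩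

/-- The sequence with the basis of `𝓖(L_M)` and given coefficients. -/
def seqOf (κ : ∀ i, GIndex k m (i + 1) → GIndex k m i → k)
    (hκ : ∀ i b, κ i b ∈ supportedOn k (GDeg k m i) (Set.Iio (GDeg k m (i + 1) b))) :
    MultigradedSeq k n where
  ι := GIndex k m
  fin := inferInstance
  deg := GDeg k m
  d i a b := monomial (GDeg k m (i + 1) b - GDeg k m i a) (κ i b a)
  multigraded i a b := by
    by_cases h : κ i b a = 0
    · exact Or.inl (by rw [h, map_zero])
    · exact Or.inr ⟨le_of_lt (hκ i b a h), _, rfl⟩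

lemma coef_seqOf (κ : ∀ i, GIndex k m (i + 1) → GIndex k m i → k)
    (hκ : ∀ i b, κ i b ∈ supportedOn k (GDeg k m i) (Set.Iio (GDeg k m (i + 1) b)))
    (i : ℕ) (a : GIndex k m i) (b : GIndex k m (i + 1)) : (seqOf κ hκ).coef i a b = κ i b a := by
  change coeff (GDeg k m (i + 1) b - GDeg k m i a)
    (monomial (GDeg k m (i + 1) b - GDeg k m i a) (κ i b a)) = _
  rw [coeff_monomial, if_pos rfl]

/-- The basis elements of degree `b` in `𝓖_{c+1}`. -/
def fiberEquiv (k : Type u) [Field k] (m : Fin r → (Fin n →₀ ℕ)) (b : LcmLattice m) (c : ℕ) :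
    Fin (Module.finrank k (RedHomology k (delta m b) c)) ≃
      {a : GIndex k m (c + 1) // GDeg k m (c + 1) a = b.1} :=
  Equiv.ofBijective
    (fun j => ⟨⟨⟨b, ne_zero_of_nontrivial (Module.nontrivial_of_finrank_pos (R := k)
      (j.1.zero_le.trans_lt j.2))⟩, j⟩, rfl⟩)
    ⟨fun j j' h => eq_of_heq (Sigma.mk.inj (Subtype.mk.inj h)).2, by
      rintro ⟨⟨⟨b', hb'⟩, j⟩, h⟩
      obtain rfl : b' = b := Subtype.ext h
      exact ⟨j, rfl⟩⟩

theorem exists_resolution_of_choices (hm : ∀ j, m j ≠ 0) (hmin : ∀ i j, m i ≤ m j → i = j)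
    (C : Choices k m) : ∃ F : MultigradedSeq k n,
      F.IsMinimalFreeResolution (monomialIdeal k m) ∧ C.G.Equal F.approx := by
  obtain ⟨v, hv⟩ := exists_chainFamily hm C (Set.toFinite Set.univ).toFinset
    (by simpa using isLowerSet_univ)
  replace hv : ∀ b, C.GoodAt v b := fun b => hv b (by simp)
  have hA : ∀ β, AdmissibleAt m (GDeg k m) (frameOf v) β :=
    fun β => admissibleAt_frameOf β fun b _ => hv b
  -- The coefficients expressing each boundary through chains of strictly smaller degree become the
  -- matrices of the resolution; strictness yields minimality.
  choose κ hκ hκv using fun i e => (hA _).bdry i e rfl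
  have hG := grounded_frameOf v
  have hbd : ∀ i e, boundary k (frameOf v (i + 1) e) =
      realize (frameOf v) i fun a => (seqOf κ hκ).coef i a e := fun i e => by
    simp only [coef_seqOf]
    exact (hκv i e).symm
  have hlt : ∀ i a b, (seqOf κ hκ).coef i a b ≠ 0 →
      (seqOf κ hκ).deg i a < (seqOf κ hκ).deg (i + 1) b :=
    fun i a b h => hκ i b a fun h0 => h ((coef_seqOf κ hκ i a b).trans h0)
  have hone' : ∀ (a : GIndex k m 0) (b : GIndex k m 1), κ 0 b a = 1 := by
    intro a b
    have h1 : boundary k (frameOf v 1 b) = Pi.single ∅ 1 := (hv b.1 0 b.2).2.2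
    obtain ⟨e₀, he₀, -, h2⟩ := hG.realize_zero (κ 0 b)
    rw [← hκv 0 b, h2] at h1
    rw [he₀ a]
    simpa using congrFun h1 ∅
  have hone : ∀ a b, (seqOf κ hκ).coef 0 a b = 1 :=
    fun a b => (coef_seqOf κ hκ 0 a b).trans (hone' a b)
  refine ⟨seqOf κ hκ, isMinimalFreeResolution_of_frame (w := frameOf v) hm hmin hG hA hbd hlt hone,
    (approx_equal_G (F := seqOf κ hκ) (w := frameOf v) hG hA hbd hlt hone C (fiberEquiv k m)
      (fun b c j => ?_) (fun b c j => ?_)).symm⟩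
  · have hb : b.1 ≠ 0 := ne_zero_of_nontrivial (Module.nontrivial_of_finrank_pos (R := k)
      (j.1.zero_le.trans_lt j.2))
    obtain ⟨z, hz, hC⟩ := (hv ⟨b, hb⟩ c j).2.2.basis_eq
    exact hC.trans (congrArg _ (Subtype.ext hz))
  · have hb : b.1 ≠ 0 := ne_zero_of_nontrivial (Module.nontrivial_of_finrank_pos (R := k)
      (j.1.zero_le.trans_lt j.2))
    exact (hv ⟨b, hb⟩ (c + 1) j).2.2

end FrameOfChoices

end

end MonRes

theorem mainTheorem4 {k : Type*} [Field k] {n r : ℕ} (m : Fin r → (Fin n →₀ ℕ))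
    (hone : ∀ j, m j ≠ 0) (hmin : ∀ i j, m i ≤ m j → i = j) :
    (∀ F : MonRes.MultigradedSeq k n,
      F.IsMinimalFreeResolution (MonRes.monomialIdeal k m) → F.StartsWith m →
        ∃ C : MonRes.Choices k m, F.approx.Equal C.G) ∧
    (∀ C : MonRes.Choices k m, ∃ F : MonRes.MultigradedSeq k n,
      F.IsMinimalFreeResolution (MonRes.monomialIdeal k m) ∧ C.G.Equal F.approx) :=
  ⟨fun _ hF hS => MonRes.exists_choices_of_resolution hone hF hS,
    fun C => MonRes.exists_resolution_of_choices hone hmin C⟩
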